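/- **Setting.** Let $\mathcal X$ be a finite alphabet, $\gamma\ge 0$, $\{\psi_a\}_{a\in\mathcal C}$ a finite collection of symmetric functions $\psi_a:\mathcal X\times\mathcal X\to[0,\infty)$, and $p$ a probability distribution on $\mathcal C$. For $N\ge 1$ let $G_N$ be the random multigraph on $[N]$ in which, independently, the number of edges between two distinct vertices $i,j$ is Poisson of mean $2\gamma/N$ and the number of loops at $i$ is Poisson of mean $\gamma/N$; each edge $e$ carries an independent label $a(e)$ with law $p$. Let the root $r$ be uniform in $[N]$ and independent of $G_N$. For a finite multigraph $G$ on a vertex set $V$ with edges labelled in $\mathcal C$, let $$\mathbb P\{X=x\mid G\}=\frac1Z\prod_{e=(ij)}\psi_{a(e)}(x_i,x_j),\qquad x\in\mathcal X^V,$$ the product being over all edges with multiplicity, with $Z=Z(G)$ the normalizing constant. The measure is defined only if $Z(G)>0$; we assume that $\liminf_{N}\mathbb P\{Z(G_N)>0\}>0$ (for instance, all $\psi_a>0$), and structures with $Z=0$ are discarded, i.e. they contribute neither to the events nor to the expectation below. For a vertex $r$ and $t\ge 0$ let $\overline{\mathsf B}(r,t)$ be the set of vertices at graph distance at least $t$ from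 $r$ (infinite distance included), and $$D_t(G,r)=\big\|\mathbb P_{r,\overline{\mathsf B}(r,t)}\{\cdot,\cdot\mid G\}-\mathbb P_r\{\cdot\mid G\}\,\mathbb P_{\overline{\mathsf B}(r,t)}\{\cdot\mid G\}\big\|_{TV},$$ where $\mathbb P_U$ is the law of $X_U=(X_j)_{j\in U}$ and $\|p-q\|_{TV}=\frac12\sum_x|p_x-q_x|$. Events $A_n$ hold *with positive probability* if there are $\delta>0$ and infinitely many $n$ with $\mathbb P(A_n)\ge\delta$. *Graph reconstruction is solvable* if there is $\varepsilon>0$ such that, for every $t\ge0$, $D_t(G_N,r)\ge\varepsilon$ with positive probability (as $N\to\infty$). Let $\mathsf T_\ell$ be the truncation at depth $\ell$ of the Galton–Watson tree with Poisson$(2\gamma)$ offspring distribution, whose edges carry independent labels of law $p$. *Tree reconstruction is solvable* if there is $\varepsilon>0$ such that, for every $t\ge 0$, $D_t(\mathsf T_\ell,\mathrm{root})>\varepsilon$ with positive probability (as $\ell\to\infty$). Given $G_N$, let $X^{(1)},X^{(2)}$ be two independent assignments with law $\mathbb P\{\cdot\mid G_N\}$, let $\nu(x,y)$ be the fraction of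 vertices $j$ with $X^{(1)}_j=x$ and $X^{(2)}_j=y$, and let $\Delta\nu(x,y)=\nu(x,y)-|\mathcal X|^{-2}$. **Theorem 1.** Assume that for every $x\in\mathcal X$ $$\mathbb E\Big\{\Big[\Delta\nu(x,x)-\frac{2}{|\mathcal X|}\sum_{x'\in\mathcal X}\Delta\nu(x,x')\Big]^2\Big\}\longrightarrow 0\qquad(N\to\infty),$$ the expectation being over $G_N$ and the two replicas. Then graph reconstruction is solvable if and only if tree reconstruction is solvable. -/

import Mathlib

open MeasureTheory ProbabilityTheory Filter Topology
open scoped NNReal ENNReal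

/-! ### Finite multigraphs with labelled edges and their graphical models -/

/-- A finite multigraph on the vertex set `V` (loops and multiple edges allowed), every edge of
which carries a label in `C`. -/
structure LabeledMultigraph (V C : Type*) where
  /-- the set of edges -/
  Edge : Type
  /-- there are finitely many edges -/
  edgeFintype : Fintype Edge
  /-- the unordered pair of end points of an edge (a diagonal pair for a loop) -/
  ends : Edge → Sym2 V
  /-- the label of an edge -/
  label : Edge → C

attribute [instance] LabeledMultigraph.edgeFintype

namespace LabeledMultigraph

noncomputable section

variable {V C X : Type*}

/-- The simple graph underlying a multigraph; it has the same distances. -/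
def toSimpleGraph (G : LabeledMultigraph V C) : SimpleGraph V :=
  SimpleGraph.fromEdgeSet (Set.range G.ends)

/-- The vertices at distance at least `t` from `r` (vertices in other components are at infinite
distance). -/
def farSet (G : LabeledMultigraph V C) (r : V) (t : ℕ) : Set V :=
  {j | (t : ℕ∞) ≤ G.toSimpleGraph.edist r j}

/-- The unnormalized weight `∏_{edges (ij)} ψ_{ij}(x_i, x_j)` of an assignment `x`.  A symmetric
weight function of two variables is a function on unordered pairs; the edge with label `a` has
the weight function `ψ a`. -/
def weight (G : LabeledMultigraph V C) (ψ : C → Sym2 X → ℝ≥0) (x : V → X) : ℝ :=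
  ∏ e : G.Edge, (ψ (G.label e) ((G.ends e).map x) : ℝ)

open Classical in
/-- The partition function. -/
def partitionFunction [Fintype V] [Fintype X] (G : LabeledMultigraph V C)
    (ψ : C → Sym2 X → ℝ≥0) : ℝ :=
  ∑ x : V → X, G.weight ψ x

/-- The probability of the assignment `x` in the graphical model.  If the partition function
vanishes, the model is not defined and this is the zero function. -/
def gibbs [Fintype V] [Fintype X] (G : LabeledMultigraph V C) (ψ : C → Sym2 X → ℝ≥0)
    (x : V → X) : ℝ :=
  G.weight ψ x / G.partitionFunction ψ

open Classical in
/-- The probability that `X_r = a`. -/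
def rootMarginal [Fintype V] [Fintype X] (G : LabeledMultigraph V C) (ψ : C → Sym2 X → ℝ≥0)
    (r : V) (a : X) : ℝ :=
  ∑ x : V → X, if x r = a then G.gibbs ψ x else 0

open Classical in
/-- The probability that `X_U = y`. -/
def marginal [Fintype V] [Fintype X] (G : LabeledMultigraph V C) (ψ : C → Sym2 X → ℝ≥0)
    (U : Set V) (y : U → X) : ℝ :=
  ∑ x : V → X, if (fun j : U => x j) = y then G.gibbs ψ x else 0

open Classical in
/-- The probability that `X_r = a` and `X_U = y`. -/
def jointMarginal [Fintype V] [Fintype X] (G : LabeledMultigraph V C) (ψ : C → Sym2 X → ℝ≥0)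
    (r : V) (U : Set V) (a : X) (y : U → X) : ℝ :=
  ∑ x : V → X, if x r = a ∧ (fun j : U => x j) = y then G.gibbs ψ x else 0

open Classical in
/-- The total variation distance between the joint law of the value at the root `r` and of the
values at distance at least `t` from `r`, and the product of their laws. -/
def rootCorrelation [Fintype V] [Fintype X] (G : LabeledMultigraph V C) (ψ : C → Sym2 X → ℝ≥0)
    (r : V) (t : ℕ) : ℝ :=
  (1 / 2 : ℝ) * ∑ a : X, ∑ y : (G.farSet r t → X),
    |G.jointMarginal ψ r (G.farSet r t) a y
      - G.rootMarginal ψ r a * G.marginal ψ (G.farSet r t) y|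

end

end LabeledMultigraph

/-! ### Poisson ensembles -/

/-- The data of a Poisson ensemble with alphabet `X`: a density, a collection of symmetric
nonnegative weight functions indexed by `C`, and a probability distribution on `C`. -/
structure PoissonEnsemble (X C : Type*) where
  /-- the density -/
  γ : ℝ≥0
  /-- the weight functions -/
  ψ : C → Sym2 X → ℝ≥0
  /-- the distribution of the weight function of an edge -/
  p : PMF C

/-- Lists carry the discrete σ-algebra. -/
instance listDiscreteMeasurableSpace (C : Type*) : MeasurableSpace (List C) := ⊤

noncomputable section

/-- The law of a list of `n` independent labels with law `p`. -/
def iidList {C : Type*} (p : PMF C) : ℕ → PMF (List C)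
  | 0 => PMF.pure []
  | n + 1 => p.bind fun a => (iidList p n).map (a :: ·)

/-- The law of a list of independent labels with law `p`, whose length is an independent Poisson
variable of mean `m`. -/
def poissonList {C : Type*} (m : ℝ≥0) (p : PMF C) : PMF (List C) :=
  (poissonMeasure m).toPMF.bind (iidList p)

/-- The multigraph on `[N]` in which `g e` lists the labels of the edges with end points `e`. -/
def multigraphOfLists {C : Type*} (N : ℕ) (g : Sym2 (Fin N) → List C) :
    LabeledMultigraph (Fin N) C where
  Edge := Σ e : Sym2 (Fin N), Fin (g e).length
  edgeFintype := inferInstance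
  ends := fun e => e.1
  label := fun e => (g e.1).get e.2

/-! ### Galton–Watson trees

The possible nodes are the words in `ℕ`: the empty word is the root and `i :: u` is the child
number `i` of `u`.  A family `ω` of lists describes the tree in which the edges from the node `u`
to its children have the labels `ω u`; in particular `u` has `(ω u).length` children. -/

/-- `u` is a node of the infinite tree described by `ω`. -/
def IsTreeNode {C : Type*} (ω : List ℕ → List C) : List ℕ → Prop
  | [] => True
  | i :: u => IsTreeNode ω u ∧ i < (ω u).length

/-- The nodes of depth at most `ℓ`. -/
def truncatedNodes {C : Type*} (ω : List ℕ → List C) (ℓ : ℕ) : Set (List ℕ) :=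
  {u | IsTreeNode ω u ∧ u.length ≤ ℓ}

theorem truncatedNodes_finite {C : Type*} (ω : List ℕ → List C) (ℓ : ℕ) :
    (truncatedNodes ω ℓ).Finite := by
  induction ℓ with
  | zero =>
    refine (Set.finite_singleton ([] : List ℕ)).subset ?_
    rintro u ⟨-, hu⟩
    simpa using hu
  | succ ℓ ih =>
    refine ((Set.finite_singleton ([] : List ℕ)).union
      (ih.biUnion fun u _ => (Set.finite_Iio (ω u).length).image fun i => i :: u)).subset ?_
    rintro u ⟨hu, hl⟩
    cases u with
    | nil => exact Or.inl rfl
    | cons i u =>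
      refine Or.inr (Set.mem_biUnion (x := u) ⟨hu.1, ?_⟩ ⟨i, hu.2, rfl⟩)
      simpa using hl

instance truncatedNodesFintype {C : Type*} (ω : List ℕ → List C) (ℓ : ℕ) :
    Fintype (truncatedNodes ω ℓ) :=
  (truncatedNodes_finite ω ℓ).fintype

theorem nil_mem_truncatedNodes {C : Type*} (ω : List ℕ → List C) (ℓ : ℕ) :
    [] ∈ truncatedNodes ω ℓ :=
  ⟨trivial, Nat.zero_le ℓ⟩

/-- The root of the truncated tree. -/
def treeRoot {C : Type*} (ω : List ℕ → List C) (ℓ : ℕ) : truncatedNodes ω ℓ :=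
  ⟨[], nil_mem_truncatedNodes ω ℓ⟩

theorem parent_mem_truncatedNodes {C : Type*} {ω : List ℕ → List C} {ℓ i : ℕ} {u : List ℕ}
    (h : i :: u ∈ truncatedNodes ω ℓ) : u ∈ truncatedNodes ω ℓ :=
  ⟨h.1.1, (Nat.le_succ u.length).trans h.2⟩

/-- The truncation at depth `ℓ` of the tree described by `ω`.  There is one edge for every node
`i :: u` other than the root; it joins `u` to `i :: u` and has the label number `i` in `ω u`. -/
def truncatedTree {C : Type*} (ω : List ℕ → List C) (ℓ : ℕ) :
    LabeledMultigraph (truncatedNodes ω ℓ) C where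
  Edge := {e : ℕ × truncatedNodes ω ℓ // e.1 :: e.2.1 ∈ truncatedNodes ω ℓ}
  edgeFintype := by
    have : Finite {e : ℕ × truncatedNodes ω ℓ // e.1 :: e.2.1 ∈ truncatedNodes ω ℓ} := by
      refine Finite.of_injective (β := truncatedNodes ω ℓ) (fun e => ⟨e.1.1 :: e.1.2.1, e.2⟩) ?_
      rintro ⟨⟨i, u, hu⟩, h⟩ ⟨⟨j, v, hv⟩, h'⟩ hij
      simpa using hij
    exact Fintype.ofFinite _
  ends := fun e => s(e.1.2, ⟨e.1.1 :: e.1.2.1, e.2⟩)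
  label := fun e => (ω e.1.2.1).get ⟨e.1.1, e.2.1.2⟩

/-! ### Random structures, reconstruction, two-replica types -/

/-- Given the numbers `P n`, the probabilities of the events `A n`: the sequence of events holds
with positive probability, i.e. there are `δ > 0` and infinitely many `n` with `P n ≥ δ`. -/
def WithPositiveProbability (P : ℕ → ℝ≥0∞) : Prop :=
  ∃ δ : ℝ≥0∞, 0 < δ ∧ ∃ᶠ n in atTop, δ ≤ P n

/-- The deviation `Δν(a, b) = ν(a, b) - 1 / |X|²` of the type of the two replicas `x₁`, `x₂`,
where `ν(a, b)` is the fraction of the vertices `j` with `x₁ j = a` and `x₂ j = b`. -/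
def typeDeviation {X : Type*} [Fintype X] {N : ℕ} (x₁ x₂ : Fin N → X) (a b : X) : ℝ :=
  ({j : Fin N | x₁ j = a ∧ x₂ j = b}.ncard : ℝ) / N - 1 / (Fintype.card X : ℝ) ^ 2

namespace PoissonEnsemble

variable {X C : Type*} (M : PoissonEnsemble X C)

open Classical in
/-- The law of the random multigraph on `[N]`: independently for all unordered pairs `e`, the
number of edges with end points `e` is Poisson of mean `2γ / N`, or `γ / N` for a loop, and all
edges have independent labels with law `p`. -/
def graphLaw (N : ℕ) : Measure (Sym2 (Fin N) → List C) :=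
  Measure.pi fun e => (poissonList (if e.IsDiag then M.γ / N else 2 * M.γ / N) M.p).toMeasure

/-- The joint law of the random multigraph and of an independent uniformly random root. -/
def rootedGraphLaw (N : ℕ) : Measure ((Sym2 (Fin N) → List C) × Fin N) :=
  (M.graphLaw N).prod (uniformOn Set.univ)

/-- The law of the labelled Galton–Watson tree with Poisson offspring of mean `2γ`. -/
def treeLaw : Measure (List ℕ → List C) :=
  Measure.infinitePi fun _ => (poissonList (2 * M.γ) M.p).toMeasure

variable [Fintype X]

/-- Reconstruction is solvable for the sequence of random graphical models. -/
def GraphSolvable : Prop :=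
  ∃ ε : ℝ, 0 < ε ∧ ∀ t : ℕ, WithPositiveProbability fun N =>
    M.rootedGraphLaw N {ω | ε ≤ (multigraphOfLists N ω.1).rootCorrelation M.ψ ω.2 t}

/-- Reconstruction is solvable for the sequence of truncated Galton–Watson trees. -/
def TreeSolvable : Prop :=
  ∃ ε : ℝ, 0 < ε ∧ ∀ t : ℕ, WithPositiveProbability fun ℓ =>
    M.treeLaw {ω | ε < (truncatedTree ω ℓ).rootCorrelation M.ψ (treeRoot ω ℓ) t}

/-- The probability that the partition function of the random multigraph on `[N]` is positive,
i.e. that its graphical model is defined. -/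
def probDefined (N : ℕ) : ℝ≥0∞ :=
  M.graphLaw N {g | 0 < (multigraphOfLists N g).partitionFunction M.ψ}

open Classical in
/-- The expectation, over the random multigraph on `[N]` and, given it, over two independent
replicas, of the square of `Δν(a, a) - (2 / |X|) ∑_b Δν(a, b)`. -/
def typeSecondMoment (N : ℕ) (a : X) : ℝ :=
  ∫ g, ∑ x₁ : Fin N → X, ∑ x₂ : Fin N → X,
    (multigraphOfLists N g).gibbs M.ψ x₁ * (multigraphOfLists N g).gibbs M.ψ x₂ *
      (typeDeviation x₁ x₂ a a
        - 2 / (Fintype.card X : ℝ) * ∑ b : X, typeDeviation x₁ x₂ a b) ^ 2 ∂(M.graphLaw N)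

end PoissonEnsemble

end

section Types

theorem abs_prod_sub_prod_le_sum {T : Type*} (s : Finset T) (a b : T → ℝ)
    (ha : ∀ u, 0 ≤ a u ∧ a u ≤ 1) (hb : ∀ u, 0 ≤ b u ∧ b u ≤ 1) :
    |∏ u ∈ s, a u - ∏ u ∈ s, b u| ≤ ∑ u ∈ s, |a u - b u| := by
  classical
  induction s using Finset.induction_on with
  | empty => simp
  | insert v s hv ih =>
    rw [Finset.prod_insert hv, Finset.prod_insert hv, Finset.sum_insert hv]
    have h1 : |∏ u ∈ s, a u| ≤ 1 := by
      rw [abs_of_nonneg (Finset.prod_nonneg fun u _ => (ha u).1)]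
      exact Finset.prod_le_one (fun u _ => (ha u).1) fun u _ => (ha u).2
    have h2 : |b v| ≤ 1 := abs_le.2 ⟨by linarith [(hb v).1], (hb v).2⟩
    calc |a v * ∏ u ∈ s, a u - b v * ∏ u ∈ s, b u|
        = |(a v - b v) * ∏ u ∈ s, a u + b v * (∏ u ∈ s, a u - ∏ u ∈ s, b u)| := by
          congr 1; ring
      _ ≤ |a v - b v| * |∏ u ∈ s, a u| + |b v| * |∏ u ∈ s, a u - ∏ u ∈ s, b u| := by
          rw [← abs_mul, ← abs_mul]; exact abs_add_le _ _
      _ ≤ |a v - b v| * 1 + 1 * ∑ u ∈ s, |a u - b u| := by gcongr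
      _ = _ := by ring

theorem sum_weight_abs_le_sqrt {Ω : Type*} [Fintype Ω] (p : Ω → ℝ) (hp : ∀ x, 0 ≤ p x)
    (h1 : ∑ x, p x = 1) (f : Ω → ℝ) : ∑ x, p x * |f x| ≤ √(∑ x, p x * f x ^ 2) := by
  apply Real.le_sqrt_of_sq_le
  set m := ∑ x, p x * |f x|
  have h : 0 ≤ ∑ x, p x * (|f x| - m) ^ 2 :=
    Finset.sum_nonneg fun x _ => mul_nonneg (hp x) (sq_nonneg _)
  have e : ∑ x, p x * (|f x| - m) ^ 2 = ∑ x, p x * f x ^ 2 - 2 * m * m + m ^ 2 * 1 := by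
    have e' : ∀ x, p x * (|f x| - m) ^ 2
        = p x * f x ^ 2 - 2 * m * (p x * |f x|) + m ^ 2 * p x := by
      intro x; rw [← sq_abs (f x)]; ring
    simp only [e', Finset.sum_add_distrib, Finset.sum_sub_distrib, ← Finset.mul_sum, h1]
    rfl
  nlinarith

variable {X T : Type*} {N : ℕ}

open Classical in
/-- The fraction of the vertices with value `a`. -/
noncomputable def valueFraction (x : Fin N → X) (a : X) : ℝ :=
  (∑ j, if x j = a then 1 else 0) / N

open Classical in
/-- The fraction of the vertices with value `a` in both replicas. -/
noncomputable def overlapFraction (x₁ x₂ : Fin N → X) (a : X) : ℝ :=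
  (∑ j, (if x₁ j = a then 1 else 0) * (if x₂ j = a then 1 else 0)) / N

theorem valueFraction_mem (x : Fin N → X) (a : X) :
    0 ≤ valueFraction x a ∧ valueFraction x a ≤ 1 := by
  classical
  unfold valueFraction
  refine ⟨by positivity, div_le_one_of_le₀ ?_ (Nat.cast_nonneg _)⟩
  calc (∑ j, if x j = a then (1 : ℝ) else 0) ≤ ∑ _j : Fin N, (1 : ℝ) :=
        Finset.sum_le_sum fun j _ => by split_ifs <;> norm_num
    _ = N := by simp

theorem overlapFraction_mem (x₁ x₂ : Fin N → X) (a : X) :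
    0 ≤ overlapFraction x₁ x₂ a ∧ overlapFraction x₁ x₂ a ≤ 1 := by
  classical
  unfold overlapFraction
  refine ⟨by positivity, div_le_one_of_le₀ ?_ (Nat.cast_nonneg _)⟩
  calc (∑ j, (if x₁ j = a then (1 : ℝ) else 0) * (if x₂ j = a then 1 else 0))
        ≤ ∑ _j : Fin N, (1 : ℝ) :=
        Finset.sum_le_sum fun j _ => by split_ifs <;> norm_num
    _ = N := by simp

variable [Fintype X] [Fintype T] [DecidableEq T]

/-- The combination of type deviations whose second moment is controlled. -/
noncomputable def typeDefect (x₁ x₂ : Fin N → X) (a : X) : ℝ :=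
  typeDeviation x₁ x₂ a a - 2 / (Fintype.card X : ℝ) * ∑ b : X, typeDeviation x₁ x₂ a b

theorem typeDefect_eq [Nonempty X] (x₁ x₂ : Fin N → X) (a : X) :
    typeDefect x₁ x₂ a = overlapFraction x₁ x₂ a
      - 2 / (Fintype.card X : ℝ) * valueFraction x₁ a + 1 / (Fintype.card X : ℝ) ^ 2 := by
  classical
  have hq : (Fintype.card X : ℝ) ≠ 0 := by exact_mod_cast Fintype.card_ne_zero
  have key : ∀ b, (({j : Fin N | x₁ j = a ∧ x₂ j = b}.ncard : ℕ) : ℝ)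
      = ∑ j, (if x₁ j = a then 1 else 0) * (if x₂ j = b then 1 else 0) := by
    intro b
    rw [Set.ncard_eq_toFinset_card', Set.toFinset_ofPred, Finset.card_filter, Nat.cast_sum]
    refine Finset.sum_congr rfl fun j _ => ?_
    by_cases h1 : x₁ j = a <;> by_cases h2 : x₂ j = b <;> simp [h1, h2]
  unfold typeDefect typeDeviation overlapFraction valueFraction
  simp only [key]
  have hs : ∑ b : X, ((∑ j, (if x₁ j = a then (1 : ℝ) else 0) * (if x₂ j = b then 1 else 0)) / N
      - 1 / (Fintype.card X : ℝ) ^ 2) = (∑ j, if x₁ j = a then (1 : ℝ) else 0) / N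
        - 1 / (Fintype.card X : ℝ) := by
    rw [Finset.sum_sub_distrib, ← Finset.sum_div, Finset.sum_comm]
    simp only [← Finset.mul_sum, Finset.sum_ite_eq, Finset.mem_univ, if_true, mul_one,
      Finset.sum_const, Finset.card_univ, nsmul_eq_mul]
    field_simp
  rw [hs]
  field_simp
  ring

/-- The second moment of the type defect under two replicas of law `p`. -/
noncomputable def defectSecondMoment (p : (Fin N → X) → ℝ) (a : X) : ℝ :=
  ∑ x₁, ∑ x₂, p x₁ * p x₂ * typeDefect x₁ x₂ a ^ 2

theorem valueFraction_secondMoment [Nonempty X] (hN : N ≠ 0) (p : (Fin N → X) → ℝ)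
    (hp : ∀ x, 0 ≤ p x) (a : X) :
    ∑ x, p x * (valueFraction x a - 1 / (Fintype.card X : ℝ)) ^ 2 ≤ √(defectSecondMoment p a) := by
  classical
  have hN' : (N : ℝ) ≠ 0 := by exact_mod_cast hN
  set c : ℝ := 1 / (Fintype.card X : ℝ) with hc
  let φ : (Fin N → X) → Fin N → ℝ := fun x j => (if x j = a then 1 else 0) - c
  let K : Fin N → Fin N → ℝ := fun i j => ∑ x, p x * (φ x i * φ x j)
  let Q : (Fin N → X) → (Fin N → X) → ℝ := fun x₁ x₂ => (∑ j, φ x₁ j * φ x₂ j) / N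
  have hQ : ∀ x₁ x₂, Q x₁ x₂ = (typeDefect x₁ x₂ a + typeDefect x₂ x₁ a) / 2 := by
    intro x₁ x₂
    rw [typeDefect_eq, typeDefect_eq]
    simp only [Q, φ, overlapFraction, valueFraction]
    have : ∀ j, ((if x₁ j = a then (1 : ℝ) else 0) - c) * ((if x₂ j = a then 1 else 0) - c)
        = (if x₁ j = a then 1 else 0) * (if x₂ j = a then 1 else 0)
          - c * (if x₁ j = a then 1 else 0) - c * (if x₂ j = a then 1 else 0) + c ^ 2 := by
      intro j; ring
    simp only [this, Finset.sum_add_distrib, Finset.sum_sub_distrib, ← Finset.mul_sum,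
      Finset.sum_const, Finset.card_univ, Fintype.card_fin, nsmul_eq_mul]
    have hcomm : ∑ j, (if x₂ j = a then (1 : ℝ) else 0) * (if x₁ j = a then 1 else 0)
        = ∑ j, (if x₁ j = a then (1 : ℝ) else 0) * (if x₂ j = a then 1 else 0) :=
      Finset.sum_congr rfl fun j _ => mul_comm _ _
    rw [hcomm]
    have : (2 : ℝ) / (Fintype.card X : ℝ) = 2 * c := by rw [hc]; ring
    rw [this, show 1 / (Fintype.card X : ℝ) ^ 2 = c ^ 2 by rw [hc]; ring]
    field_simp
    ring
  have hQm : ∑ x₁, ∑ x₂, p x₁ * p x₂ * Q x₁ x₂ ^ 2 ≤ defectSecondMoment p a := by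
    have hsw : ∑ x₁, ∑ x₂, p x₁ * p x₂ * typeDefect x₂ x₁ a ^ 2
        = ∑ x₁, ∑ x₂, p x₁ * p x₂ * typeDefect x₁ x₂ a ^ 2 := by
      rw [Finset.sum_comm]
      refine Finset.sum_congr rfl fun x _ => Finset.sum_congr rfl fun y _ => by ring
    have : defectSecondMoment p a = ∑ x₁, ∑ x₂, p x₁ * p x₂ *
        ((typeDefect x₁ x₂ a ^ 2 + typeDefect x₂ x₁ a ^ 2) / 2) := by
      have : ∀ x₁ x₂, p x₁ * p x₂ * ((typeDefect x₁ x₂ a ^ 2 + typeDefect x₂ x₁ a ^ 2) / 2)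
        = p x₁ * p x₂ * typeDefect x₁ x₂ a ^ 2 / 2 + p x₁ * p x₂ * typeDefect x₂ x₁ a ^ 2 / 2 := by
        intro x₁ x₂; ring
      simp only [this, Finset.sum_add_distrib, ← Finset.sum_div, hsw]
      unfold defectSecondMoment
      ring
    rw [this]
    refine Finset.sum_le_sum fun x₁ _ => Finset.sum_le_sum fun x₂ _ => ?_
    refine mul_le_mul_of_nonneg_left ?_ (mul_nonneg (hp _) (hp _))
    rw [hQ]
    nlinarith [sq_nonneg (typeDefect x₁ x₂ a - typeDefect x₂ x₁ a)]
  have hQK : ∑ x₁, ∑ x₂, p x₁ * p x₂ * Q x₁ x₂ ^ 2 = (∑ i, ∑ j, K i j ^ 2) / (N : ℝ) ^ 2 := by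
    have e1 : ∀ x₁ x₂, p x₁ * p x₂ * Q x₁ x₂ ^ 2
        = (∑ i, ∑ j, (p x₁ * (φ x₁ i * φ x₁ j)) * (p x₂ * (φ x₂ i * φ x₂ j))) / (N : ℝ) ^ 2 := by
      intro x₁ x₂
      simp only [Q]
      rw [div_pow, pow_two (∑ j, φ x₁ j * φ x₂ j), Finset.sum_mul_sum, mul_div_assoc',
        Finset.mul_sum]
      congr 1
      refine Finset.sum_congr rfl fun i _ => ?_
      rw [Finset.mul_sum]
      exact Finset.sum_congr rfl fun j _ => by ring
    simp only [e1, ← Finset.sum_div]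
    congr 1
    have e2 : ∀ i j, K i j ^ 2
        = ∑ x₁, ∑ x₂, (p x₁ * (φ x₁ i * φ x₁ j)) * (p x₂ * (φ x₂ i * φ x₂ j)) := by
      intro i j
      rw [pow_two, Finset.sum_mul_sum]
    simp only [e2]
    calc _ = ∑ x₁, ∑ i, ∑ j, ∑ x₂, (p x₁ * (φ x₁ i * φ x₁ j)) * (p x₂ * (φ x₂ i * φ x₂ j)) := by
          refine Finset.sum_congr rfl fun x₁ _ => ?_
          rw [Finset.sum_comm]
          exact Finset.sum_congr rfl fun i _ => Finset.sum_comm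
      _ = _ := by
          rw [Finset.sum_comm]
          exact Finset.sum_congr rfl fun i _ => Finset.sum_comm
  have hS : ∑ x, p x * (valueFraction x a - c) ^ 2 = (∑ i, ∑ j, K i j) / (N : ℝ) ^ 2 := by
    have e1 : ∀ x, p x * (valueFraction x a - c) ^ 2
        = (∑ i, ∑ j, p x * (φ x i * φ x j)) / (N : ℝ) ^ 2 := by
      intro x
      have : valueFraction x a - c = (∑ j, φ x j) / N := by
        simp only [valueFraction, φ, Finset.sum_sub_distrib, Finset.sum_const, Finset.card_univ,
          Fintype.card_fin, nsmul_eq_mul]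
        field_simp
      rw [this, div_pow, pow_two (∑ j, φ x j), Finset.sum_mul_sum, mul_div_assoc', Finset.mul_sum]
      simp only [Finset.mul_sum]
    simp only [e1, ← Finset.sum_div]
    congr 1
    rw [Finset.sum_comm]
    refine Finset.sum_congr rfl fun i _ => ?_
    rw [Finset.sum_comm]
  apply Real.le_sqrt_of_sq_le
  rw [hS]
  refine le_trans ?_ (hQK ▸ hQm)
  have hcs : (∑ i, ∑ j, K i j) ^ 2 ≤ (N : ℝ) ^ 2 * ∑ i, ∑ j, K i j ^ 2 := by
    have := sq_sum_le_card_mul_sum_sq (s := (Finset.univ : Finset (Fin N × Fin N)))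
      (f := fun z => K z.1 z.2)
    simpa [Fintype.sum_prod_type, pow_two] using this
  rw [div_pow, div_le_div_iff₀ (by positivity) (by positivity)]
  nlinarith [sq_nonneg (N : ℝ)]

open Classical in
/-- The probability that the values at the vertices `j` are `ξ`. -/
noncomputable def localMarginal {V : Type*} [Fintype V] [DecidableEq V] (p : (V → X) → ℝ)
    (j : T → V) (ξ : T → X) : ℝ :=
  ∑ x, if x ∘ j = ξ then p x else 0

theorem sum_localMarginal_sub_sq_le [Nonempty X] (hN : N ≠ 0) (p : (Fin N → X) → ℝ)
    (hp : ∀ x, 0 ≤ p x) (h1 : ∑ x, p x = 1) (ξ : T → X) :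
    (∑ j : T → Fin N,
      (localMarginal p j ξ - (1 / (Fintype.card X : ℝ)) ^ Fintype.card T) ^ 2)
      / (N : ℝ) ^ Fintype.card T
      ≤ ∑ u, (√(defectSecondMoment p (ξ u)) + 4 * √√(defectSecondMoment p (ξ u))) := by
  classical
  have hN' : (N : ℝ) ≠ 0 := by exact_mod_cast hN
  set c : ℝ := 1 / (Fintype.card X : ℝ) with hc
  have hc0 : 0 ≤ c := by positivity
  have hc1 : c ≤ 1 := by
    rw [hc]; apply div_le_one_of_le₀ _ (Nat.cast_nonneg _)
    exact_mod_cast Fintype.card_pos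
  set n := Fintype.card T with hn
  have ind : ∀ (x : Fin N → X) (j : T → Fin N), (if x ∘ j = ξ then (1 : ℝ) else 0)
      = ∏ u, if x (j u) = ξ u then 1 else 0 := by
    intro x j
    by_cases h : x ∘ j = ξ
    · rw [if_pos h]
      symm
      exact Finset.prod_eq_one fun u _ => if_pos (congrFun h u)
    · rw [if_neg h]
      obtain ⟨u, hu⟩ := Function.ne_iff.1 h
      exact (Finset.prod_eq_zero (Finset.mem_univ u) (if_neg hu)).symm
  have lm : ∀ j, localMarginal p j ξ = ∑ x, p x * ∏ u, if x (j u) = ξ u then 1 else 0 := by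
    intro j
    unfold localMarginal
    refine Finset.sum_congr rfl fun x _ => ?_
    rw [← ind]; split_ifs <;> simp
  have a1 : (∑ j : T → Fin N, localMarginal p j ξ) / (N : ℝ) ^ n
      = ∑ x, p x * ∏ u, valueFraction x (ξ u) := by
    simp only [lm]
    rw [Finset.sum_comm, Finset.sum_div]
    refine Finset.sum_congr rfl fun x _ => ?_
    rw [← Finset.mul_sum, mul_div_assoc]
    congr 1
    simp only [valueFraction, Finset.prod_div_distrib, Finset.prod_const, Finset.card_univ, ← hn]
    congr 1
    rw [Finset.prod_univ_sum, Fintype.piFinset_univ]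
  have a2 : (∑ j : T → Fin N, localMarginal p j ξ ^ 2) / (N : ℝ) ^ n
      = ∑ x₁, ∑ x₂, p x₁ * p x₂ * ∏ u, overlapFraction x₁ x₂ (ξ u) := by
    simp only [lm, pow_two, Finset.sum_mul_sum]
    rw [Finset.sum_comm, Finset.sum_div]
    refine Finset.sum_congr rfl fun x₁ _ => ?_
    rw [Finset.sum_comm, Finset.sum_div]
    refine Finset.sum_congr rfl fun x₂ _ => ?_
    have : ∀ j : T → Fin N, (p x₁ * ∏ u, if x₁ (j u) = ξ u then (1 : ℝ) else 0)
        * (p x₂ * ∏ u, if x₂ (j u) = ξ u then 1 else 0)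
        = p x₁ * p x₂ * ∏ u, ((if x₁ (j u) = ξ u then (1 : ℝ) else 0)
          * (if x₂ (j u) = ξ u then 1 else 0)) := by
      intro j; rw [Finset.prod_mul_distrib]; ring
    simp only [this]
    rw [← Finset.mul_sum, mul_div_assoc]
    congr 1
    simp only [overlapFraction, Finset.prod_div_distrib, Finset.prod_const, Finset.card_univ, ← hn]
    congr 1
    rw [Finset.prod_univ_sum, Fintype.piFinset_univ]
  have hcard : (∑ _j : T → Fin N, (1 : ℝ)) / (N : ℝ) ^ n = 1 := by
    simp [hn, hN']
  have hpp : ∑ x₁, ∑ x₂, p x₁ * p x₂ = 1 := by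
    rw [← Finset.sum_mul_sum, h1]; norm_num
  have expand : (∑ j : T → Fin N, (localMarginal p j ξ - c ^ n) ^ 2) / (N : ℝ) ^ n
      = ∑ x₁, ∑ x₂, p x₁ * p x₂ * (∏ u, overlapFraction x₁ x₂ (ξ u) - (c ^ 2) ^ n)
        - 2 * c ^ n * ∑ x, p x * (∏ u, valueFraction x (ξ u) - c ^ n) := by
    have e : ∀ j : T → Fin N, (localMarginal p j ξ - c ^ n) ^ 2
        = localMarginal p j ξ ^ 2 - 2 * c ^ n * localMarginal p j ξ + (c ^ 2) ^ n * 1 := by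
      intro j; rw [pow_right_comm]; ring
    simp only [e, Finset.sum_add_distrib, Finset.sum_sub_distrib, ← Finset.mul_sum, mul_sub]
    rw [add_div, sub_div, mul_div_assoc, mul_div_assoc, a1, a2, hcard]
    simp only [← Finset.sum_mul]
    rw [h1, hpp]
    have : (c ^ 2) ^ n = c ^ n * c ^ n := by rw [pow_right_comm]; ring
    rw [this]; ring
  rw [expand]
  have b1 : ∀ a, ∑ x, p x * |valueFraction x a - c| ≤ √√(defectSecondMoment p a) := fun a =>
    (sum_weight_abs_le_sqrt p hp h1 _).trans
      (Real.sqrt_le_sqrt (valueFraction_secondMoment hN p hp a))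
  have b2 : ∀ a, ∑ x₁, ∑ x₂, p x₁ * p x₂ * |typeDefect x₁ x₂ a| ≤ √(defectSecondMoment p a) := by
    intro a
    have := sum_weight_abs_le_sqrt (fun z : (Fin N → X) × (Fin N → X) => p z.1 * p z.2)
      (fun z => mul_nonneg (hp _) (hp _)) (by rw [Fintype.sum_prod_type]; exact hpp)
      (fun z => typeDefect z.1 z.2 a)
    simpa only [Fintype.sum_prod_type, defectSecondMoment] using this
  have b3 : ∀ a, ∑ x₁, ∑ x₂, p x₁ * p x₂ * |overlapFraction x₁ x₂ a - c ^ 2|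
      ≤ √(defectSecondMoment p a) + 2 * √√(defectSecondMoment p a) := by
    intro a
    have hle : ∀ x₁ x₂, p x₁ * p x₂ * |overlapFraction x₁ x₂ a - c ^ 2|
        ≤ p x₁ * p x₂ * |typeDefect x₁ x₂ a| + 2 * (p x₁ * |valueFraction x₁ a - c|) * p x₂ := by
      intro x₁ x₂
      have : |overlapFraction x₁ x₂ a - c ^ 2| ≤ |typeDefect x₁ x₂ a|
          + 2 * |valueFraction x₁ a - c| := by
        have e : overlapFraction x₁ x₂ a - c ^ 2
            = typeDefect x₁ x₂ a + 2 * c * (valueFraction x₁ a - c) := by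
          rw [typeDefect_eq, hc]; ring
        rw [e]
        refine (abs_add_le _ _).trans ?_
        rw [abs_mul, abs_of_nonneg (by positivity : (0 : ℝ) ≤ 2 * c)]
        have := abs_nonneg (valueFraction x₁ a - c)
        nlinarith
      calc _ ≤ p x₁ * p x₂ * (|typeDefect x₁ x₂ a| + 2 * |valueFraction x₁ a - c|) :=
            mul_le_mul_of_nonneg_left this (mul_nonneg (hp _) (hp _))
        _ = _ := by ring
    refine (Finset.sum_le_sum fun x₁ _ => Finset.sum_le_sum fun x₂ _ => hle x₁ x₂).trans ?_
    simp only [Finset.sum_add_distrib, ← Finset.mul_sum, h1, mul_one]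
    have := b1 a
    have := b2 a
    simp only [mul_assoc] at *
    simp only [← Finset.mul_sum] at *
    linarith
  have c1 : ∑ x₁, ∑ x₂, p x₁ * p x₂ * (∏ u, overlapFraction x₁ x₂ (ξ u) - (c ^ 2) ^ n)
      ≤ ∑ u, (√(defectSecondMoment p (ξ u)) + 2 * √√(defectSecondMoment p (ξ u))) := by
    calc _ ≤ ∑ x₁, ∑ x₂, p x₁ * p x₂ * ∑ u, |overlapFraction x₁ x₂ (ξ u) - c ^ 2| := by
          refine Finset.sum_le_sum fun x₁ _ => Finset.sum_le_sum fun x₂ _ => ?_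
          refine mul_le_mul_of_nonneg_left ?_ (mul_nonneg (hp _) (hp _))
          refine (le_abs_self _).trans ?_
          have := abs_prod_sub_prod_le_sum Finset.univ (fun u => overlapFraction x₁ x₂ (ξ u))
            (fun _ => c ^ 2) (fun u => overlapFraction_mem _ _ _)
            (fun u => ⟨by positivity, pow_le_one₀ hc0 hc1⟩)
          simpa [hn] using this
      _ = ∑ u, ∑ x₁, ∑ x₂, p x₁ * p x₂ * |overlapFraction x₁ x₂ (ξ u) - c ^ 2| := by
          simp only [Finset.mul_sum]
          rw [Finset.sum_comm]
          conv_rhs => rw [Finset.sum_comm]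
          rw [Finset.sum_comm]
          exact Finset.sum_congr rfl fun x₁ _ => Finset.sum_comm
      _ ≤ _ := Finset.sum_le_sum fun u _ => b3 _
  have c2 : -(∑ x, p x * (∏ u, valueFraction x (ξ u) - c ^ n))
      ≤ ∑ u, √√(defectSecondMoment p (ξ u)) := by
    calc _ ≤ ∑ x, p x * ∑ u, |valueFraction x (ξ u) - c| := by
          rw [← Finset.sum_neg_distrib]
          refine Finset.sum_le_sum fun x _ => ?_
          rw [← mul_neg]
          refine mul_le_mul_of_nonneg_left ?_ (hp _)
          refine (neg_le_abs _).trans ?_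
          have := abs_prod_sub_prod_le_sum Finset.univ (fun u => valueFraction x (ξ u))
            (fun _ => c) (fun u => valueFraction_mem _ _) (fun u => ⟨hc0, hc1⟩)
          simpa [hn] using this
      _ = ∑ u, ∑ x, p x * |valueFraction x (ξ u) - c| := by
          simp only [Finset.mul_sum]
          rw [Finset.sum_comm]
      _ ≤ _ := Finset.sum_le_sum fun u _ => b1 _
  have hcn : c ^ n ≤ 1 := pow_le_one₀ hc0 hc1
  have hcn0 : 0 ≤ c ^ n := by positivity
  have hs0 : 0 ≤ ∑ u, √√(defectSecondMoment p (ξ u)) :=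
    Finset.sum_nonneg fun _ _ => Real.sqrt_nonneg _
  have hfin : ∑ u, (√(defectSecondMoment p (ξ u)) + 4 * √√(defectSecondMoment p (ξ u)))
      = ∑ u, (√(defectSecondMoment p (ξ u)) + 2 * √√(defectSecondMoment p (ξ u)))
        + 2 * ∑ u, √√(defectSecondMoment p (ξ u)) := by
    rw [Finset.mul_sum, ← Finset.sum_add_distrib]
    exact Finset.sum_congr rfl fun u _ => by ring
  rw [hfin]
  nlinarith

end Types

section Correlation

variable {V T X : Type*} [Fintype V] [DecidableEq V] [Fintype T] [DecidableEq T] [Fintype X]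

open Classical in
/-- The weight of the configurations with value `a` at `r`. -/
noncomputable def siteMarginal (r : V) (π : (V → X) → ℝ) (a : X) : ℝ :=
  ∑ x, (if x r = a then 1 else 0) * π x

open Classical in
/-- The total variation distance between the joint law of the value at `r` and of the values in
`F`, and the product of their laws, when the configurations have law `π`. -/
noncomputable def siteCorrelation (r : V) (F : Set V) (π : (V → X) → ℝ) : ℝ :=
  (1 / 2 : ℝ) * ∑ a : X, ∑ y : F → X,
    |∑ x : V → X, (if (fun j : F => x j) = y then 1 else 0) *
      (((if x r = a then 1 else 0) - siteMarginal r π a) * π x)|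

theorem LabeledMultigraph.rootCorrelation_eq_siteCorrelation {C : Type*}
    (G : LabeledMultigraph V C) (ψ : C → Sym2 X → ℝ≥0) (r : V) (t : ℕ) :
    G.rootCorrelation ψ r t = siteCorrelation r (G.farSet r t) (G.gibbs ψ) := by
  unfold LabeledMultigraph.rootCorrelation siteCorrelation
  congr 1
  refine Finset.sum_congr rfl fun a _ => ?_
  have hR : G.rootMarginal ψ r a = siteMarginal r (G.gibbs ψ) a := by
    unfold LabeledMultigraph.rootMarginal siteMarginal
    simp only [ite_mul, one_mul, zero_mul]
    congr!
  rw [hR]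
  refine Finset.sum_congr (by congr!) fun y _ => ?_
  congr 1
  unfold LabeledMultigraph.jointMarginal LabeledMultigraph.marginal
  rw [Finset.mul_sum, ← Finset.sum_sub_distrib]
  have : ∀ (p q : Prop) [Decidable p] [Decidable q] (c d : ℝ),
      (if p ∧ q then d else 0) - c * (if q then d else 0)
        = (if q then 1 else 0) * (((if p then 1 else 0) - c) * d) := by
    intro p q _ _ c d
    by_cases hp : p <;> by_cases hq : q <;> simp [hp, hq]; ring
  simp only [this]
  congr!

theorem LabeledMultigraph.partitionFunction_eq_sum {C : Type*} (G : LabeledMultigraph V C)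
    (ψ : C → Sym2 X → ℝ≥0) : G.partitionFunction ψ = ∑ x, G.weight ψ x := by
  unfold LabeledMultigraph.partitionFunction
  congr!

theorem continuous_siteCorrelation (r : V) (F : Set V) :
    Continuous fun π : (V → X) → ℝ => siteCorrelation r F π := by
  unfold siteCorrelation siteMarginal
  fun_prop

/-- If the weight of a configuration is the product of a function of its restriction to the
image of `ι` and of a function of its restriction to `F`, where the image of `ι` contains the
complement of `F`, then the correlation between a site and `F` can be computed on the domain of
`ι`. -/
theorem siteCorrelation_mul_comp (ι : T → V) (hι : Function.Injective ι) (F : Set V) (F₀ : Set T)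
    (hF : ∀ u, ι u ∈ F ↔ u ∈ F₀) (hFc : ∀ v ∉ F, v ∈ Set.range ι) (W : (V → X) → ℝ)
    (hW : ∀ x, 0 ≤ W x) (hWF : ∀ x x', (∀ v ∈ F, x v = x' v) → W x = W x')
    (w : (T → X) → ℝ) (r : T) :
    siteCorrelation (ι r) F (fun x => w (x ∘ ι) * W x)
      = siteCorrelation r F₀ (fun ξ => w ξ * localMarginal W ι ξ) := by
  classical
  rcases isEmpty_or_nonempty X with hX | ⟨⟨a₀⟩⟩
  · unfold siteCorrelation; simp
  have hfib : ∀ b : (T → X) → ℝ, ∑ x : V → X, b (x ∘ ι) * W x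
      = ∑ ξ, b ξ * localMarginal W ι ξ := by
    intro b
    unfold localMarginal
    simp only [Finset.mul_sum, mul_ite, mul_zero]
    rw [Finset.sum_comm]
    simp
  have hR : ∀ a, siteMarginal (ι r) (fun x => w (x ∘ ι) * W x) a
      = siteMarginal r (fun ξ => w ξ * localMarginal W ι ξ) a := by
    intro a
    unfold siteMarginal
    have := hfib fun ξ => (if ξ r = a then 1 else 0) * w ξ
    simpa only [mul_assoc, Function.comp_apply] using this
  unfold siteCorrelation
  congr 1
  refine Finset.sum_congr rfl fun a _ => ?_
  rw [hR]
  set R := siteMarginal r (fun ξ => w ξ * localMarginal W ι ξ) a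
  let b : (T → X) → ℝ := fun ξ => ((if ξ r = a then 1 else 0) - R) * w ξ
  let z : (F → X) → (F₀ → X) := fun y u => y ⟨ι u, (hF u).2 u.2⟩
  let e₁ : (F → X) → ((F₀ᶜ : Set T) → X) → V → X := fun y ζ v =>
    if h : v ∈ F then y ⟨v, h⟩ else ζ ⟨(hFc v h).choose, fun h' => h (by
      have := (hF _).2 h'
      rwa [(hFc v h).choose_spec] at this)⟩
  let e₀ : (F₀ → X) → ((F₀ᶜ : Set T) → X) → T → X := fun y ζ u =>
    if h : u ∈ F₀ then y ⟨u, h⟩ else ζ ⟨u, h⟩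
  have he : ∀ y ζ, e₁ y ζ ∘ ι = e₀ (z y) ζ := by
    intro y ζ
    funext u
    by_cases h : u ∈ F₀
    · have h' := (hF u).2 h
      simp [e₁, e₀, z, h, h']
    · have h' : ι u ∉ F := fun h' => h ((hF u).1 h')
      simp only [Function.comp_apply, e₁, e₀, h, h', dif_neg, not_false_iff]
      congr 1
      exact Subtype.ext (hι (hFc _ h').choose_spec)
  have sum₁ : ∀ (y : F → X) (f : (V → X) → ℝ),
      ∑ x : V → X, (if (fun j : F => x j) = y then 1 else 0) * f x = ∑ ζ, f (e₁ y ζ) := by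
    intro y f
    simp only [ite_mul, one_mul, zero_mul]
    rw [← Finset.sum_filter]
    symm
    refine Finset.sum_bij' (fun ζ _ => e₁ y ζ) (fun x _ u => x (ι u)) ?_ ?_ ?_ ?_ ?_
    · intro ζ _
      simp only [Finset.mem_filter, Finset.mem_univ, true_and]
      funext j; simp [e₁, j.2]
    · intro x _; exact Finset.mem_univ _
    · intro ζ _
      funext u
      have h := congrFun (he y ζ) u
      have hu : (u : T) ∉ F₀ := u.2
      simpa [e₀, hu] using h
    · intro x hx
      simp only [Finset.mem_filter, Finset.mem_univ, true_and] at hx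
      funext v
      by_cases h : v ∈ F
      · simp only [e₁, h, dif_pos]; rw [← hx]
      · simp only [e₁, h, dif_neg, not_false_iff]
        exact congrArg x (hFc v h).choose_spec
    · intro ζ _; rfl
  have sum₀ : ∀ (y : F₀ → X) (f : (T → X) → ℝ),
      ∑ x : T → X, (if (fun j : F₀ => x j) = y then 1 else 0) * f x = ∑ ζ, f (e₀ y ζ) := by
    intro y f
    simp only [ite_mul, one_mul, zero_mul]
    rw [← Finset.sum_filter]
    symm
    refine Finset.sum_bij' (fun ζ _ => e₀ y ζ) (fun x _ u => x u) ?_ ?_ ?_ ?_ ?_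
    · intro ζ _
      simp only [Finset.mem_filter, Finset.mem_univ, true_and]
      funext j; simp [e₀, j.2]
    · intro x _; exact Finset.mem_univ _
    · intro ζ _
      funext u
      have hu : (u : T) ∉ F₀ := u.2
      simp [e₀, hu]
    · intro x hx
      simp only [Finset.mem_filter, Finset.mem_univ, true_and] at hx
      funext v
      by_cases h : v ∈ F₀
      · simp only [e₀, h, dif_pos]; rw [← hx]
      · simp only [e₀, h, dif_neg, not_false_iff]
    · intro ζ _; rfl
  let W' : (F → X) → ℝ := fun y => W (e₁ y fun _ => a₀)
  have hW' : ∀ y ζ, W (e₁ y ζ) = W' y := by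
    intro y ζ
    apply hWF
    intro v hv
    simp [e₁, hv]
  let B : (F₀ → X) → ℝ := fun y => ∑ ζ, b (e₀ y ζ)
  let k : (F₀ → X) → ℝ := fun y₀ => ∑ y : F → X, if z y = y₀ then W' y else 0
  have hk0 : ∀ y₀, 0 ≤ k y₀ := fun y₀ => Finset.sum_nonneg fun y _ => by
    split_ifs
    · exact hW _
    · exact le_rfl
  have hK : ∀ y₀ ζ, localMarginal W ι (e₀ y₀ ζ) = k y₀ := by
    intro y₀ ζ
    have hfibre : ∀ f : (V → X) → ℝ, ∑ x, f x = ∑ y, ∑ ζ, f (e₁ y ζ) := by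
      intro f
      simp only [← sum₁]
      rw [Finset.sum_comm]
      simp
    unfold localMarginal
    rw [hfibre]
    refine Finset.sum_congr rfl fun y _ => ?_
    simp only [he, hW']
    have hinj : ∀ ζ', e₀ (z y) ζ' = e₀ y₀ ζ ↔ z y = y₀ ∧ ζ' = ζ := by
      intro ζ'
      constructor
      · intro h
        constructor
        · funext u
          have := congrFun h u
          simpa [e₀, u.2] using this
        · funext u
          have hu : (u : T) ∉ F₀ := u.2
          have := congrFun h u
          simpa [e₀, hu] using this
      · rintro ⟨rfl, rfl⟩; rfl
    simp only [hinj, ite_and]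
    split_ifs <;> simp
  have lhs : ∀ y : F → X, ∑ x : V → X, (if (fun j : F => x j) = y then 1 else 0) *
      (((if x (ι r) = a then 1 else 0) - R) * (w (x ∘ ι) * W x)) = W' y * B (z y) := by
    intro y
    rw [sum₁, Finset.mul_sum]
    refine Finset.sum_congr rfl fun ζ _ => ?_
    rw [hW', ← he]
    simp only [b, Function.comp_apply]
    ring
  have rhs : ∀ y : F₀ → X, ∑ x : T → X, (if (fun j : F₀ => x j) = y then 1 else 0) *
      (((if x r = a then 1 else 0) - R) * (w x * localMarginal W ι x)) = k y * B y := by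
    intro y
    rw [sum₀, Finset.mul_sum]
    refine Finset.sum_congr rfl fun ζ _ => ?_
    rw [hK]
    simp only [b]
    ring
  simp only [lhs, rhs, abs_mul, abs_of_nonneg (hk0 _)]
  have hW'' : ∀ y, |W' y| = W' y := fun y => abs_of_nonneg (hW _)
  simp only [hW'', k, Finset.sum_mul, ite_mul, zero_mul]
  rw [Finset.sum_comm]
  simp

/-- A law on configurations obtained by reweighting. -/
noncomputable def normalizedProduct (w μ : (T → X) → ℝ) (ξ : T → X) : ℝ :=
  w ξ * μ ξ / ∑ ξ', w ξ' * μ ξ'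

theorem exists_siteCorrelation_near [Nonempty X] (w : (T → X) → ℝ) (hw : ∑ ξ, w ξ ≠ 0) (r : T)
    (F : Set T) {ε : ℝ} (hε : 0 < ε) :
    ∃ θ : ℝ, 0 < θ ∧ ∀ μ : (T → X) → ℝ,
      (∀ ξ, |μ ξ - (1 / (Fintype.card X : ℝ)) ^ Fintype.card T| < θ) →
      0 < (∑ ξ, w ξ * μ ξ) / ∑ ξ, w ξ ∧
      |siteCorrelation r F (normalizedProduct w μ)
        - siteCorrelation r F fun ξ => w ξ / ∑ ξ', w ξ'| < ε := by
  set c : ℝ := (1 / (Fintype.card X : ℝ)) ^ Fintype.card T with hc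
  have hc0 : 0 < c := by
    have : 0 < (Fintype.card X : ℝ) := by exact_mod_cast Fintype.card_pos
    positivity
  have hn : normalizedProduct w (fun _ => c) = fun ξ => w ξ / ∑ ξ', w ξ' := by
    funext ξ
    unfold normalizedProduct
    rw [← Finset.sum_mul]
    field_simp
  have hS : Continuous fun μ : (T → X) → ℝ => (∑ ξ, w ξ * μ ξ) := by fun_prop
  have hcont : ContinuousAt (fun μ => siteCorrelation r F (normalizedProduct w μ))
      (fun _ => c) := by
    refine (continuous_siteCorrelation r F).continuousAt.comp ?_
    unfold normalizedProduct
    refine continuousAt_pi.2 fun ξ => ContinuousAt.div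
      (continuous_const.mul (continuous_apply ξ)).continuousAt hS.continuousAt ?_
    simp only [← Finset.sum_mul]
    exact mul_ne_zero hw hc0.ne'
  have h1 : ∀ᶠ μ in 𝓝 (fun _ => c : (T → X) → ℝ), 0 < (∑ ξ, w ξ * μ ξ) / ∑ ξ, w ξ := by
    have hd : Continuous fun μ : (T → X) → ℝ => (∑ ξ, w ξ * μ ξ) / ∑ ξ, w ξ :=
      hS.div_const _
    refine hd.continuousAt.eventually (lt_mem_nhds ?_)
    simp only [← Finset.sum_mul]
    rwa [mul_div_cancel_left₀ _ hw]
  have h2 := hcont.eventually (Metric.ball_mem_nhds _ hε)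
  obtain ⟨θ, hθ, h⟩ := Metric.eventually_nhds_iff.1 (h1.and h2)
  refine ⟨θ, hθ, fun μ hμ => ?_⟩
  have := h ((dist_pi_lt_iff hθ).2 fun ξ => by rw [Real.dist_eq]; exact hμ ξ)
  simp only [hn, Real.dist_eq] at this
  exact this

end Correlation

section Planting

variable {T C X : Type*}

/-- A multigraph without multiple edges in which every vertex is joined to the root by a path
along which the depth increases by one at every step, and all edges join consecutive depths. -/
structure IsLayered (G : LabeledMultigraph T C) (r : T) (depth : T → ℕ) (ℓ : ℕ) : Prop where
  ends_injective : Function.Injective G.ends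
  depth_root : depth r = 0
  depth_le : ∀ u, depth u ≤ ℓ
  exists_parent : ∀ v, v = r ∨ ∃ k u, G.ends k = s(u, v) ∧ depth v = depth u + 1
  edge_depth : ∀ k, ∃ u v, G.ends k = s(u, v) ∧ depth v = depth u + 1

theorem LabeledMultigraph.farSet_eq_of_depth {V : Type*} (G : LabeledMultigraph V C) (r : V)
    (d : V → ℕ) (ℓ t : ℕ) (ht : t ≤ ℓ) (hr : d r = 0)
    (hadj : ∀ v w, G.toSimpleGraph.Adj v w → d w ≤ d v + 1)
    (hpar : ∀ v, d v < ℓ → v = r ∨ ∃ w, G.toSimpleGraph.Adj w v ∧ d v = d w + 1) :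
    G.farSet r t = {v | t ≤ d v} := by
  have hwalk : ∀ {u v : V} (p : G.toSimpleGraph.Walk u v), d v ≤ d u + p.length := by
    intro u v p
    induction p with
    | nil => simp
    | cons h p ih =>
      have := hadj _ _ h
      rw [SimpleGraph.Walk.length_cons]
      omega
  have hlow : ∀ v, (d v : ℕ∞) ≤ G.toSimpleGraph.edist r v := by
    intro v
    refine le_iInf fun p => ?_
    have := hwalk p
    rw [hr, zero_add] at this
    exact_mod_cast this
  have hup : ∀ n v, d v = n → n < ℓ → G.toSimpleGraph.edist r v ≤ n := by
    intro n
    induction n with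
    | zero =>
      intro v hv hn
      rcases hpar v (hv ▸ hn) with rfl | ⟨w, -, hw⟩
      · simp
      · omega
    | succ n ih =>
      intro v hv hn
      rcases hpar v (hv ▸ hn) with rfl | ⟨w, hw, hd⟩
      · simp
      · refine (SimpleGraph.edist_triangle (v := w)).trans ?_
        rw [SimpleGraph.edist_eq_one_iff_adj.2 hw]
        push_cast
        gcongr
        exact ih w (by omega) (by omega)
  ext v
  simp only [LabeledMultigraph.farSet, Set.mem_ofPred_eq]
  constructor
  · intro h
    by_contra hlt
    have h1 := hup _ v rfl (by omega)
    have := h.trans h1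
    exact hlt (by exact_mod_cast this)
  · intro h
    exact le_trans (by exact_mod_cast h) (hlow v)

theorem LabeledMultigraph.toSimpleGraph_adj {V : Type*} (G : LabeledMultigraph V C) (v w : V) :
    G.toSimpleGraph.Adj v w ↔ (∃ k, G.ends k = s(v, w)) ∧ v ≠ w := by
  simp [LabeledMultigraph.toSimpleGraph]

theorem IsLayered.edge_depth_of_eq {G : LabeledMultigraph T C} {r : T} {depth : T → ℕ} {ℓ : ℕ}
    (h : IsLayered G r depth ℓ) {k : G.Edge} {u v : T} (hk : G.ends k = s(u, v)) :
    depth v = depth u + 1 ∨ depth u = depth v + 1 := by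
  obtain ⟨u', v', h1, h2⟩ := h.edge_depth k
  rw [hk, Sym2.eq_iff] at h1
  rcases h1 with ⟨rfl, rfl⟩ | ⟨rfl, rfl⟩
  · exact Or.inl h2
  · exact Or.inr h2

theorem IsLayered.farSet_eq {G : LabeledMultigraph T C} {r : T} {depth : T → ℕ} {ℓ : ℕ}
    (h : IsLayered G r depth ℓ) (t : ℕ) : G.farSet r t = {v | t ≤ depth v} := by
  refine G.farSet_eq_of_depth r depth t t le_rfl h.depth_root ?_ ?_
  · intro v w hvw
    obtain ⟨⟨k, hk⟩, -⟩ := (G.toSimpleGraph_adj v w).1 hvw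
    rcases h.edge_depth_of_eq hk with h | h <;> omega
  · intro v _
    rcases h.exists_parent v with rfl | ⟨k, u, hk, hd⟩
    · exact Or.inl rfl
    · refine Or.inr ⟨u, (G.toSimpleGraph_adj u v).2 ⟨⟨k, hk⟩, ?_⟩, hd⟩
      rintro rfl
      omega

variable {V : Type*}

open Classical in
/-- The lists of labels of the image of a multigraph without multiple edges. -/
noncomputable def plantedLists (G : LabeledMultigraph T C) (ι : T → V) (e : Sym2 V) : List C :=
  if h : ∃ k, (G.ends k).map ι = e then [G.label h.choose] else []

/-- The pairs which meet the image of `I`. -/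
def touching (I : Set T) (ι : T → V) : Set (Sym2 V) := {e | ∃ u ∈ I, ι u ∈ e}

/-- The edges meeting the image of `I` are those of the image of `G`. -/
def plantedEvent (G : LabeledMultigraph T C) (I : Set T) (ι : T → V) : Set (Sym2 V → List C) :=
  {g | ∀ e ∈ touching I ι, g e = plantedLists G ι e}

open Classical in
/-- Remove the edges which meet the image of `I`. -/
noncomputable def removeTouching (I : Set T) (ι : T → V) (g : Sym2 V → List C) :
    Sym2 V → List C :=
  fun e => if e ∈ touching I ι then [] else g e

theorem plantedLists_map_ends {G : LabeledMultigraph T C} (hG : Function.Injective G.ends)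
    {ι : T → V} (hι : Function.Injective ι) (k : G.Edge) :
    plantedLists G ι ((G.ends k).map ι) = [G.label k] := by
  have h : ∃ k', (G.ends k').map ι = (G.ends k).map ι := ⟨k, rfl⟩
  rw [plantedLists, dif_pos h]
  rw [hG (Sym2.map.injective hι h.choose_spec)]

theorem plantedLists_of_forall_ne {G : LabeledMultigraph T C} {ι : T → V} {e : Sym2 V}
    (h : ∀ k, (G.ends k).map ι ≠ e) : plantedLists G ι e = [] := by
  rw [plantedLists, dif_neg]
  push Not
  exact h

theorem exists_of_plantedLists_ne_nil {G : LabeledMultigraph T C} {ι : T → V} {e : Sym2 V}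
    (h : plantedLists G ι e ≠ []) : ∃ k, (G.ends k).map ι = e := by
  by_contra h'
  push Not at h'
  exact h (plantedLists_of_forall_ne h')

theorem weight_multigraphOfLists {N : ℕ} (g : Sym2 (Fin N) → List C) (ψ : C → Sym2 X → ℝ≥0)
    (x : Fin N → X) : (multigraphOfLists N g).weight ψ x
      = ∏ e, ((g e).map fun a => (ψ a (e.map x) : ℝ)).prod := by
  unfold LabeledMultigraph.weight
  have : ∀ e, ((g e).map fun a => (ψ a (e.map x) : ℝ)).prod
      = ∏ i : Fin (g e).length, (ψ ((g e).get i) (e.map x) : ℝ) := by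
    intro e
    rw [← List.prod_ofFn]
    congr 1
    conv_lhs => rw [← List.ofFn_get (g e), List.map_ofFn]
    rfl
  simp only [this]
  exact Fintype.prod_sigma (fun k : (Σ e : Sym2 (Fin N), Fin (g e).length) =>
    (ψ ((g k.1).get k.2) (k.1.map x) : ℝ))

theorem LabeledMultigraph.weight_nonneg (G : LabeledMultigraph V C) (ψ : C → Sym2 X → ℝ≥0)
    (x : V → X) : 0 ≤ G.weight ψ x :=
  Finset.prod_nonneg fun _ _ => NNReal.coe_nonneg _

/-- The vertices of depth less than `ℓ`. -/
def innerSet (depth : T → ℕ) (ℓ : ℕ) : Set T := {u | depth u < ℓ}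

theorem IsLayered.map_ends_mem_touching {G : LabeledMultigraph T C} {r : T} {depth : T → ℕ} {ℓ : ℕ}
    (h : IsLayered G r depth ℓ) (ι : T → V) (k : G.Edge) :
    (G.ends k).map ι ∈ touching (innerSet depth ℓ) ι := by
  obtain ⟨u, v, hk, hd⟩ := h.edge_depth k
  refine ⟨u, ?_, ?_⟩
  · have := h.depth_le v
    simp only [innerSet, Set.mem_ofPred_eq]
    omega
  · rw [hk, Sym2.map_mk]
    exact Sym2.mem_mk_left _ _

theorem IsLayered.weight_eq_mul {G : LabeledMultigraph T C} {r : T} {depth : T → ℕ} {ℓ : ℕ}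
    (h : IsLayered G r depth ℓ) {N : ℕ} {ι : T → Fin N} (hι : Function.Injective ι)
    {g : Sym2 (Fin N) → List C} (hg : g ∈ plantedEvent G (innerSet depth ℓ) ι)
    (ψ : C → Sym2 X → ℝ≥0) (x : Fin N → X) :
    (multigraphOfLists N g).weight ψ x = G.weight ψ (x ∘ ι) *
      (multigraphOfLists N (removeTouching (innerSet depth ℓ) ι g)).weight ψ x := by
  classical
  rw [weight_multigraphOfLists, weight_multigraphOfLists]
  have h1 : G.weight ψ (x ∘ ι)
      = ∏ e, ((plantedLists G ι e).map fun a => (ψ a (e.map x) : ℝ)).prod := by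
    refine Fintype.prod_of_injective (fun k => (G.ends k).map ι)
      ((Sym2.map.injective hι).comp h.ends_injective) _ _ ?_ ?_
    · intro e he
      rw [plantedLists_of_forall_ne fun k hk => he ⟨k, hk⟩]
      simp
    · intro k
      rw [plantedLists_map_ends h.ends_injective hι]
      simp [Sym2.map_map]
  rw [h1, ← Finset.prod_mul_distrib]
  refine Finset.prod_congr rfl fun e _ => ?_
  by_cases he : e ∈ touching (innerSet depth ℓ) ι
  · simp [removeTouching, he, hg e he]
  · rw [plantedLists_of_forall_ne (G := G) fun k hk => he (by
      rw [← hk]; exact h.map_ends_mem_touching ι k)]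
    simp [removeTouching, he]

theorem weight_removeTouching_congr {N : ℕ} (I : Set T) (ι : T → Fin N)
    (g : Sym2 (Fin N) → List C) (ψ : C → Sym2 X → ℝ≥0) {x x' : Fin N → X}
    (hx : ∀ v, (∀ u ∈ I, ι u ≠ v) → x v = x' v) :
    (multigraphOfLists N (removeTouching I ι g)).weight ψ x
      = (multigraphOfLists N (removeTouching I ι g)).weight ψ x' := by
  classical
  rw [weight_multigraphOfLists, weight_multigraphOfLists]
  refine Finset.prod_congr rfl fun e _ => ?_
  by_cases he : e ∈ touching I ι
  · simp [removeTouching, he]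
  · have : e.map x = e.map x' := by
      refine Sym2.map_congr fun v hv => hx v ?_
      rintro u hu rfl
      exact he ⟨u, hu, hv⟩
    rw [this]

theorem multigraphOfLists_adj {N : ℕ} (g : Sym2 (Fin N) → List C) (v w : Fin N) :
    (multigraphOfLists N g).toSimpleGraph.Adj v w ↔ g s(v, w) ≠ [] ∧ v ≠ w := by
  rw [LabeledMultigraph.toSimpleGraph_adj]
  refine and_congr_left fun _ => ?_
  constructor
  · rintro ⟨⟨e, i⟩, hk⟩ hnil
    have hk' : e = s(v, w) := hk
    subst hk'
    rw [hnil] at i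
    exact i.elim0
  · intro h
    exact ⟨⟨s(v, w), ⟨0, List.length_pos_iff.2 h⟩⟩, rfl⟩

theorem IsLayered.farSet_multigraphOfLists {G : LabeledMultigraph T C} {r : T} {depth : T → ℕ}
    {ℓ : ℕ} (h : IsLayered G r depth ℓ) {N : ℕ} {ι : T → Fin N} (hι : Function.Injective ι)
    {g : Sym2 (Fin N) → List C} (hg : g ∈ plantedEvent G (innerSet depth ℓ) ι) {t : ℕ}
    (ht : t ≤ ℓ) : (multigraphOfLists N g).farSet (ι r) t = {v | ∀ u, ι u = v → t ≤ depth u} := by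
  classical
  let d : Fin N → ℕ := fun v => if hv : ∃ u, ι u = v then depth hv.choose else ℓ
  have hdι : ∀ u, d (ι u) = depth u := by
    intro u
    have hv : ∃ u', ι u' = ι u := ⟨u, rfl⟩
    simp only [d, dif_pos hv]
    rw [hι hv.choose_spec]
  have hdn : ∀ v, (¬ ∃ u, ι u = v) → d v = ℓ := fun v hv => by simp only [d, dif_neg hv]
  rw [LabeledMultigraph.farSet_eq_of_depth _ (ι r) d ℓ t ht (by rw [hdι, h.depth_root])]
  · ext v
    simp only [Set.mem_ofPred_eq]
    by_cases hv : ∃ u, ι u = v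
    · obtain ⟨u, rfl⟩ := hv
      rw [hdι]
      exact ⟨fun h' u' hu' => hι hu' ▸ h', fun h' => h' u rfl⟩
    · rw [hdn v hv]
      exact ⟨fun _ u hu => absurd ⟨u, hu⟩ hv, fun _ => ht⟩
  · intro v w hvw
    obtain ⟨hne, -⟩ := (multigraphOfLists_adj g v w).1 hvw
    by_cases he : s(v, w) ∈ touching (innerSet depth ℓ) ι
    · rw [hg _ he] at hne
      obtain ⟨k, hk⟩ := exists_of_plantedLists_ne_nil hne
      obtain ⟨u₁, u₂, hu, hd⟩ := h.edge_depth k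
      rw [hu, Sym2.map_mk, Sym2.eq_iff] at hk
      rcases hk with ⟨rfl, rfl⟩ | ⟨rfl, rfl⟩ <;> rw [hdι, hdι] <;> omega
    · have hge : ∀ z ∈ s(v, w), d z = ℓ := by
        intro z hz
        by_cases hv : ∃ u, ι u = z
        · obtain ⟨u, rfl⟩ := hv
          rw [hdι]
          have h1 := h.depth_le u
          by_contra hlt
          exact he ⟨u, lt_of_le_of_ne h1 hlt, hz⟩
        · exact hdn z hv
      rw [hge v (Sym2.mem_mk_left _ _), hge w (Sym2.mem_mk_right _ _)]
      omega
  · intro v hv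
    by_cases hv' : ∃ u, ι u = v
    · obtain ⟨u, rfl⟩ := hv'
      rcases h.exists_parent u with rfl | ⟨k, p, hk, hd⟩
      · exact Or.inl rfl
      · refine Or.inr ⟨ι p, (multigraphOfLists_adj g _ _).2 ⟨?_, ?_⟩, by rw [hdι, hdι, hd]⟩
        · have hk' : (G.ends k).map ι = s(ι p, ι u) := by rw [hk, Sym2.map_mk]
          rw [← hk', hg _ (h.map_ends_mem_touching ι k),
            plantedLists_map_ends h.ends_injective hι]
          exact List.cons_ne_nil _ _
        · intro heq
          rw [hι heq] at hd
          omega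
    · rw [hdn v hv'] at hv
      exact absurd hv (lt_irrefl _)

theorem LabeledMultigraph.partitionFunction_nonneg [Fintype V] [Fintype X]
    (G : LabeledMultigraph V C) (ψ : C → Sym2 X → ℝ≥0) : 0 ≤ G.partitionFunction ψ :=
  Finset.sum_nonneg fun _ _ => G.weight_nonneg ψ _

theorem LabeledMultigraph.rootCorrelation_eq_zero [Fintype V] [Fintype X]
    {G : LabeledMultigraph V C} {ψ : C → Sym2 X → ℝ≥0} (h : G.partitionFunction ψ = 0) (r : V)
    (t : ℕ) : G.rootCorrelation ψ r t = 0 := by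
  classical
  rw [G.rootCorrelation_eq_siteCorrelation]
  have : G.gibbs ψ = 0 := by
    funext x
    simp [LabeledMultigraph.gibbs, h]
  rw [this]
  simp [siteCorrelation]

/-- Removing edges leaves a model with a positive partition function. -/
theorem partitionFunction_removeTouching_pos [Fintype X] (I : Set T) {N : ℕ} (ι : T → Fin N)
    {g : Sym2 (Fin N) → List C} {ψ : C → Sym2 X → ℝ≥0}
    (hZ : 0 < (multigraphOfLists N g).partitionFunction ψ) :
    0 < (multigraphOfLists N (removeTouching I ι g)).partitionFunction ψ := by
  rw [LabeledMultigraph.partitionFunction_eq_sum] at hZ ⊢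
  obtain ⟨x, -, hx⟩ := Finset.exists_ne_zero_of_sum_ne_zero hZ.ne'
  refine Finset.sum_pos' (fun x _ => LabeledMultigraph.weight_nonneg _ _ _)
    ⟨x, Finset.mem_univ _, lt_of_le_of_ne (LabeledMultigraph.weight_nonneg _ _ _) (Ne.symm ?_)⟩
  rw [weight_multigraphOfLists, Finset.prod_ne_zero_iff] at hx ⊢
  intro e he
  unfold removeTouching
  split_ifs
  · simp
  · exact hx e he

theorem IsLayered.exists_rootCorrelation_near [Fintype T] [DecidableEq T] [Fintype X] [Nonempty X]
    {G : LabeledMultigraph T C} {r : T} {depth : T → ℕ} {ℓ : ℕ} (h : IsLayered G r depth ℓ)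
    (ψ : C → Sym2 X → ℝ≥0) {t : ℕ} (ht : t ≤ ℓ) {ε : ℝ} (hε : 0 < ε) :
    ∃ θ : ℝ, 0 < θ ∧ ∀ (N : ℕ) (ι : T → Fin N), Function.Injective ι →
      ∀ g ∈ plantedEvent G (innerSet depth ℓ) ι,
      0 < (multigraphOfLists N (removeTouching (innerSet depth ℓ) ι g)).partitionFunction ψ →
      (∀ ξ, |localMarginal ((multigraphOfLists N
        (removeTouching (innerSet depth ℓ) ι g)).gibbs ψ) ι ξ
          - (1 / (Fintype.card X : ℝ)) ^ Fintype.card T| < θ) →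
      |(multigraphOfLists N g).rootCorrelation ψ (ι r) t - G.rootCorrelation ψ r t| < ε := by
  classical
  rcases (G.partitionFunction_nonneg ψ).eq_or_lt with hZ0 | hZ0
  · refine ⟨1, one_pos, fun N ι hι g hg _ _ => ?_⟩
    have hw : ∀ x, G.weight ψ x = 0 := by
      intro x
      rw [LabeledMultigraph.partitionFunction_eq_sum, eq_comm,
        Finset.sum_eq_zero_iff_of_nonneg fun _ _ => G.weight_nonneg ψ _] at hZ0
      exact hZ0 x (Finset.mem_univ _)
    have hZg : (multigraphOfLists N g).partitionFunction ψ = 0 := by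
      rw [LabeledMultigraph.partitionFunction_eq_sum]
      refine Finset.sum_eq_zero fun x _ => ?_
      rw [h.weight_eq_mul hι hg, hw, zero_mul]
    rw [LabeledMultigraph.rootCorrelation_eq_zero hZg,
      LabeledMultigraph.rootCorrelation_eq_zero hZ0.symm]
    simpa using hε
  have hsum : ∑ ξ, G.weight ψ ξ = G.partitionFunction ψ := (G.partitionFunction_eq_sum ψ).symm
  obtain ⟨θ, hθ, hmain⟩ := exists_siteCorrelation_near (G.weight ψ) (by rw [hsum]; exact hZ0.ne')
    r (G.farSet r t) hε
  refine ⟨θ, hθ, fun N ι hι g hg hZ' hξ => ?_⟩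
  set g' := removeTouching (innerSet depth ℓ) ι g
  set W := (multigraphOfLists N g').weight ψ with hW
  set Z' := (multigraphOfLists N g').partitionFunction ψ
  set Z := (multigraphOfLists N g).partitionFunction ψ with hZdef
  obtain ⟨hpos, hnear⟩ := hmain _ hξ
  have hlm : ∀ (c : ℝ) ξ, localMarginal (fun x => W x / c) ι ξ = localMarginal W ι ξ / c := by
    intro c ξ
    unfold localMarginal
    rw [Finset.sum_div]
    refine Finset.sum_congr rfl fun x _ => ?_
    split_ifs <;> simp
  have hg' : (multigraphOfLists N g').gibbs ψ = fun x => W x / Z' := rfl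
  have hZeq : Z = ∑ ξ, G.weight ψ ξ * localMarginal W ι ξ := by
    rw [hZdef, LabeledMultigraph.partitionFunction_eq_sum]
    simp only [h.weight_eq_mul hι hg]
    unfold localMarginal
    simp only [Finset.mul_sum, mul_ite, mul_zero]
    rw [Finset.sum_comm]
    simp [hW, g']
  have hZZ : ∑ ξ, G.weight ψ ξ * localMarginal ((multigraphOfLists N g').gibbs ψ) ι ξ = Z / Z' := by
    rw [hg', hZeq, Finset.sum_div]
    simp only [hlm, mul_div_assoc]
  have hZpos : 0 < Z := by
    rw [hZZ, hsum] at hpos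
    have := (div_pos_iff_of_pos_right hZ0).1 hpos
    exact (div_pos_iff_of_pos_right hZ').1 this
  rw [LabeledMultigraph.rootCorrelation_eq_siteCorrelation,
    LabeledMultigraph.rootCorrelation_eq_siteCorrelation]
  have hgibbs : (multigraphOfLists N g).gibbs ψ = fun x => G.weight ψ (x ∘ ι) * (W x / Z) := by
    funext x
    unfold LabeledMultigraph.gibbs
    rw [h.weight_eq_mul hι hg, mul_div_assoc]
  have hG : G.gibbs ψ = fun ξ => G.weight ψ ξ / ∑ ξ', G.weight ψ ξ' := by
    funext x
    unfold LabeledMultigraph.gibbs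
    rw [hsum]
  rw [hgibbs, hG, siteCorrelation_mul_comp ι hι _ (G.farSet r t)]
  · convert hnear using 5
    rename_i ξ
    unfold normalizedProduct
    rw [hZZ, hg', hlm, hlm]
    field_simp
  · intro u
    rw [h.farSet_multigraphOfLists hι hg ht, h.farSet_eq]
    exact ⟨fun h' => h' u rfl, fun h' u' hu' => hι hu' ▸ h'⟩
  · intro v hv
    rw [h.farSet_multigraphOfLists hι hg ht] at hv
    simp only [Set.mem_ofPred_eq, not_forall] at hv
    obtain ⟨u, hu, -⟩ := hv
    exact ⟨u, hu⟩
  · intro x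
    exact div_nonneg (LabeledMultigraph.weight_nonneg _ _ _) hZpos.le
  · intro x x' hx
    rw [hW, weight_removeTouching_congr (innerSet depth ℓ) ι g ψ (x' := x')]
    intro v hv
    apply hx
    rw [h.farSet_multigraphOfLists hι hg ht]
    intro u hu
    by_contra hlt
    exact hv u (lt_of_lt_of_le (not_le.1 hlt) ht) hu

end Planting

section GraphLaw

variable {C X : Type*}

theorem iidList_apply (p : PMF C) (n : ℕ) (l : List C) :
    iidList p n l = if l.length = n then (l.map p).prod else 0 := by
  classical
  induction n generalizing l with
  | zero =>
    cases l <;> simp [iidList, PMF.pure_apply]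
  | succ n ih =>
    simp only [iidList, PMF.bind_apply, PMF.map_apply]
    cases l with
    | nil => simp
    | cons b l =>
      rw [tsum_eq_single b]
      · rw [tsum_eq_single l]
        · simp [ih]
        · intro l' hl'
          simp [hl'.symm]
      · intro a ha
        simp [ha.symm]

theorem poissonList_apply (m : ℝ≥0) (p : PMF C) (l : List C) :
    poissonList m p l = ENNReal.ofReal (Real.exp (-m) * m ^ l.length / (l.length).factorial)
      * (l.map p).prod := by
  unfold poissonList
  rw [PMF.bind_apply, tsum_eq_single l.length]
  · rw [iidList_apply, if_pos rfl, Measure.toPMF_apply, poissonMeasure_singleton]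
  · intro n hn
    rw [iidList_apply, if_neg hn.symm, mul_zero]

theorem measurableSet_list (s : Set (List C)) : MeasurableSet s := trivial

theorem poissonList_real_singleton (m : ℝ≥0) (p : PMF C) (l : List C) :
    (poissonList m p).toMeasure.real {l}
      = Real.exp (-m) * m ^ l.length / (l.length).factorial * (l.map fun a => (p a).toReal).prod := by
  rw [measureReal_def, PMF.toMeasure_apply_singleton _ _ (measurableSet_list _),
    poissonList_apply, ENNReal.toReal_mul, ENNReal.toReal_ofReal (by positivity)]
  congr 1
  induction l with
  | nil => simp
  | cons a l ih => simp [ih]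

instance listMeasurableSingletonClass : MeasurableSingletonClass (List C) :=
  ⟨fun _ => measurableSet_list _⟩

variable (M : PoissonEnsemble X C)

/-- The mean number of edges with given end points. -/
noncomputable def edgeMean (γ : ℝ≥0) (N : ℕ) (e : Sym2 (Fin N)) : ℝ≥0 := by
  classical
  exact if e.IsDiag then γ / N else 2 * γ / N

theorem graphLaw_eq (N : ℕ) :
    M.graphLaw N = Measure.pi fun e => (poissonList (edgeMean M.γ N e) M.p).toMeasure := by
  unfold PoissonEnsemble.graphLaw edgeMean
  congr!

instance isProbabilityMeasure_graphLaw (N : ℕ) : IsProbabilityMeasure (M.graphLaw N) := by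
  rw [graphLaw_eq]
  infer_instance

theorem measureReal_inter_of_disjoint_coordinates [Finite C] {N : ℕ} (S : Set (Sym2 (Fin N)))
    (A B : Set (Sym2 (Fin N) → List C))
    (hA : ∀ g g', (∀ e ∈ S, g e = g' e) → g ∈ A → g' ∈ A)
    (hB : ∀ g g', (∀ e ∉ S, g e = g' e) → g ∈ B → g' ∈ B) :
    (M.graphLaw N).real (A ∩ B) = (M.graphLaw N).real A * (M.graphLaw N).real B := by
  classical
  have hind := (iIndepFun_pi (μ := fun e => (poissonList (edgeMean M.γ N e) M.p).toMeasure)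
    (X := fun _ (l : List C) => l) (fun _ => aemeasurable_id)).indepFun_finset
    S.toFinset Sᶜ.toFinset (by
      rw [Set.disjoint_toFinset]; exact disjoint_compl_right) (fun e => measurable_pi_apply e)
  rw [← graphLaw_eq] at hind
  let res : (Sym2 (Fin N) → List C) → S.toFinset → List C := fun g e => g e
  let res' : (Sym2 (Fin N) → List C) → Sᶜ.toFinset → List C := fun g e => g e
  have hA' : A = res ⁻¹' (res '' A) := by
    refine Set.Subset.antisymm (Set.subset_preimage_image _ _) ?_
    rintro g ⟨g', hg', hres⟩
    exact hA g' g (fun e he => congrFun hres ⟨e, Set.mem_toFinset.2 he⟩) hg'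
  have hB' : B = res' ⁻¹' (res' '' B) := by
    refine Set.Subset.antisymm (Set.subset_preimage_image _ _) ?_
    rintro g ⟨g', hg', hres⟩
    exact hB g' g (fun e he => congrFun hres ⟨e, Set.mem_toFinset.2 he⟩) hg'
  have := (indepFun_iff_measure_inter_preimage_eq_mul.1 hind) (res '' A) (res' '' B)
    (MeasurableSet.of_discrete) (MeasurableSet.of_discrete)
  change M.graphLaw N (res ⁻¹' _ ∩ res' ⁻¹' _) = M.graphLaw N (res ⁻¹' _) *
    M.graphLaw N (res' ⁻¹' _) at this
  rw [← hA', ← hB'] at this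
  simp only [measureReal_def, this, ENNReal.toReal_mul]

variable {T : Type*}

/-- No edge meets the image of `I`. -/
def isolatedEvent {V : Type*} (I : Set T) (ι : T → V) : Set (Sym2 V → List C) :=
  {g | ∀ e ∈ touching I ι, g e = []}

theorem graphLaw_real_forall_eq [Finite C] {N : ℕ} (S : Set (Sym2 (Fin N)))
    [DecidablePred (· ∈ S)] (L : Sym2 (Fin N) → List C) :
    (M.graphLaw N).real {g | ∀ e ∈ S, g e = L e}
      = ∏ e, if e ∈ S then (poissonList (edgeMean M.γ N e) M.p).toMeasure.real {L e} else 1 := by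
  have : {g | ∀ e ∈ S, g e = L e} = Set.univ.pi fun e => if e ∈ S then {L e} else Set.univ := by
    ext g
    simp only [Set.mem_ofPred_eq, Set.mem_univ_pi]
    refine forall_congr' fun e => ?_
    by_cases he : e ∈ S <;> simp [he]
  rw [this, measureReal_def, graphLaw_eq, Measure.pi_pi, ENNReal.toReal_prod]
  refine Finset.prod_congr rfl fun e _ => ?_
  split_ifs
  · rfl
  · simp

theorem graphLaw_real_isolatedEvent [Finite C] {N : ℕ} (I : Set T) (ι : T → Fin N)
    [DecidablePred (· ∈ touching I ι)] :
    (M.graphLaw N).real (isolatedEvent I ι)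
      = ∏ e, if e ∈ touching I ι then Real.exp (-edgeMean M.γ N e) else 1 := by
  unfold isolatedEvent
  rw [graphLaw_real_forall_eq M (touching I ι) fun _ => []]
  refine Finset.prod_congr rfl fun e _ => ?_
  rw [poissonList_real_singleton]
  simp

variable {r : T} {depth : T → ℕ} {ℓ : ℕ} {G : LabeledMultigraph T C}

/-- The factor by which an isolated set of vertices is less likely to be planted. -/
noncomputable def plantingFactor (N : ℕ) (G : LabeledMultigraph T C) : ℝ :=
  ∏ k : G.Edge, (2 * M.γ / N * (M.p (G.label k)).toReal : ℝ)

theorem plantingFactor_le (N : ℕ) (G : LabeledMultigraph T C) :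
    plantingFactor M N G ≤ (2 * M.γ / N : ℝ) ^ Fintype.card G.Edge := by
  unfold plantingFactor
  calc _ ≤ ∏ _k : G.Edge, (2 * M.γ / N : ℝ) := by
        refine Finset.prod_le_prod (fun _ _ => by positivity) fun k _ => ?_
        refine mul_le_of_le_one_right (by positivity) ?_
        exact ENNReal.toReal_le_of_le_ofReal zero_le_one (by simpa using M.p.coe_le_one _)
    _ = _ := by rw [Finset.prod_const, Finset.card_univ]

theorem IsLayered.graphLaw_real_plantedEvent [Finite C] (h : IsLayered G r depth ℓ) {N : ℕ}
    {ι : T → Fin N} (hι : Function.Injective ι) :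
    (M.graphLaw N).real (plantedEvent G (innerSet depth ℓ) ι)
      = (M.graphLaw N).real (isolatedEvent (innerSet depth ℓ) ι) * plantingFactor M N G := by
  classical
  have hpf : plantingFactor M N G = ∏ e : Sym2 (Fin N),
      if e ∈ touching (innerSet depth ℓ) ι then
        (edgeMean M.γ N e : ℝ) ^ (plantedLists G ι e).length / ((plantedLists G ι e).length).factorial
          * ((plantedLists G ι e).map fun a => (M.p a).toReal).prod else 1 := by
    refine Fintype.prod_of_injective (fun k => (G.ends k).map ι)
      ((Sym2.map.injective hι).comp h.ends_injective) _ _ ?_ ?_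
    · intro e he
      rw [plantedLists_of_forall_ne fun k hk => he ⟨k, hk⟩]
      simp
    · intro k
      rw [if_pos (h.map_ends_mem_touching ι k), plantedLists_map_ends h.ends_injective hι]
      have : ¬ ((G.ends k).map ι).IsDiag := by
        obtain ⟨u, v, hk, hd⟩ := h.edge_depth k
        rw [hk, Sym2.map_mk, Sym2.mk_isDiag_iff]
        intro huv
        rw [hι huv] at hd
        omega
      simp [edgeMean, this]
  unfold plantedEvent
  rw [graphLaw_real_forall_eq, graphLaw_real_isolatedEvent, hpf, ← Finset.prod_mul_distrib]
  refine Finset.prod_congr rfl fun e _ => ?_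
  split_ifs
  · rw [poissonList_real_singleton]; ring
  · simp

theorem graphLaw_real_inter_removeTouching [Finite C] {N : ℕ} (I : Set T) (ι : T → Fin N)
    (L : Sym2 (Fin N) → List C) (B : Set (Sym2 (Fin N) → List C)) :
    (M.graphLaw N).real ({g | ∀ e ∈ touching I ι, g e = L e} ∩ removeTouching I ι ⁻¹' B)
      = (M.graphLaw N).real {g | ∀ e ∈ touching I ι, g e = L e}
        * (M.graphLaw N).real (removeTouching I ι ⁻¹' B) := by
  refine measureReal_inter_of_disjoint_coordinates M (touching I ι) _ _ ?_ ?_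
  · intro g g' hgg hg e he
    rw [← hgg e he, hg e he]
  · intro g g' hgg hg
    have : removeTouching I ι g' = removeTouching I ι g := by
      funext e
      unfold removeTouching
      split_ifs with he
      · rfl
      · exact (hgg e he).symm
    simpa [this] using hg

/-- Planting costs at most the planting factor, for events that concern the rest of the graph. -/
theorem IsLayered.graphLaw_real_plantedEvent_mul_le [Finite C] (h : IsLayered G r depth ℓ) {N : ℕ}
    {ι : T → Fin N} (hι : Function.Injective ι) (B : Set (Sym2 (Fin N) → List C)) :
    (M.graphLaw N).real (plantedEvent G (innerSet depth ℓ) ι)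
        * (M.graphLaw N).real (removeTouching (innerSet depth ℓ) ι ⁻¹' B)
      ≤ (2 * M.γ / N : ℝ) ^ Fintype.card G.Edge * (M.graphLaw N).real B := by
  set I := innerSet depth ℓ
  have hiso : (M.graphLaw N).real (isolatedEvent I ι ∩ removeTouching I ι ⁻¹' B)
      = (M.graphLaw N).real (isolatedEvent I ι)
        * (M.graphLaw N).real (removeTouching I ι ⁻¹' B) :=
    graphLaw_real_inter_removeTouching M I ι (fun _ => []) B
  rw [h.graphLaw_real_plantedEvent M hι, mul_right_comm, ← hiso, mul_comm]
  refine mul_le_mul (plantingFactor_le M N G) ?_ measureReal_nonneg (by positivity)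
  refine measureReal_mono ?_
  rintro g ⟨hg, hg'⟩
  have : removeTouching I ι g = g := by
    funext e
    unfold removeTouching
    split_ifs with he
    · exact (hg e he).symm
    · rfl
  rwa [Set.mem_preimage, this] at hg'

theorem exp_neg_le_graphLaw_real_isolatedEvent [Finite C] {N : ℕ} (hN : N ≠ 0) (I : Set T)
    (hI : I.Finite) (ι : T → Fin N) :
    Real.exp (-(2 * M.γ)) ^ I.ncard ≤ (M.graphLaw N).real (isolatedEvent I ι) := by
  classical
  have hN' : (N : ℝ) ≠ 0 := by exact_mod_cast hN
  rw [graphLaw_real_isolatedEvent]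
  calc Real.exp (-(2 * M.γ)) ^ I.ncard
      ≤ Real.exp (-(2 * M.γ / N)) ^ (Finset.univ.filter (· ∈ touching I ι)).card := by
        rw [← Real.exp_nat_mul, ← Real.exp_nat_mul, Real.exp_le_exp]
        have hcard : (Finset.univ.filter (· ∈ touching I ι)).card ≤ I.ncard * N := by
          have hsub : Finset.univ.filter (· ∈ touching I ι) ⊆
              (hI.toFinset ×ˢ (Finset.univ : Finset (Fin N))).image fun z => s(ι z.1, z.2) := by
            intro e he
            simp only [Finset.mem_filter, Finset.mem_univ, true_and] at he
            obtain ⟨u, hu, hue⟩ := he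
            obtain ⟨v, rfl⟩ := Sym2.mem_iff_exists.1 hue
            exact Finset.mem_image.2 ⟨(u, v), by simpa using hu, rfl⟩
          refine (Finset.card_le_card hsub).trans (Finset.card_image_le.trans ?_)
          rw [Finset.card_product, Finset.card_univ, Fintype.card_fin,
            Set.ncard_eq_toFinset_card I hI]
        have : ((Finset.univ.filter (· ∈ touching I ι)).card : ℝ) ≤ I.ncard * N := by
          exact_mod_cast hcard
        have hγ : (0 : ℝ) ≤ 2 * M.γ / N := by positivity
        have h2 := mul_le_mul_of_nonneg_right this hγ
        have h3 : (I.ncard * N : ℝ) * (2 * M.γ / N) = I.ncard * (2 * M.γ) := by field_simp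
        linarith
    _ = ∏ e, if e ∈ touching I ι then Real.exp (-(2 * M.γ / N)) else 1 := by
        rw [← Finset.prod_filter, Finset.prod_const]
    _ ≤ _ := by
        refine Finset.prod_le_prod (fun e _ => by split_ifs <;> positivity) fun e _ => ?_
        split_ifs
        · rw [Real.exp_le_exp, neg_le_neg_iff]
          unfold edgeMean
          split_ifs
          · push_cast
            gcongr
            linarith [M.γ.2, show (M.γ : ℝ) = M.γ.1 from rfl]
          · push_cast; rfl
        · exact le_rfl

theorem rootedGraphLaw_real [Finite C] {N : ℕ} (S : Set ((Sym2 (Fin N) → List C) × Fin N)) :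
    (M.rootedGraphLaw N).real S = (∑ r, (M.graphLaw N).real {g | (g, r) ∈ S}) / N := by
  classical
  have hu : ∀ r : Fin N, (uniformOn (Set.univ : Set (Fin N))) {r} = (N : ℝ≥0∞)⁻¹ := by
    intro r
    rw [uniformOn_univ]
    simp
  have hS : S = ⋃ r, {g | (g, r) ∈ S} ×ˢ {r} := by
    ext ⟨g, r⟩
    simp
  rcases Nat.eq_zero_or_pos N with rfl | hN
  · have : S = ∅ := Set.eq_empty_of_forall_notMem fun z _ => z.2.elim0
    simp [this]
  have : Nonempty (Fin N) := ⟨⟨0, hN⟩⟩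
  have : IsProbabilityMeasure (uniformOn (Set.univ : Set (Fin N))) :=
    isProbabilityMeasure_uniformOn Set.finite_univ Set.univ_nonempty
  have : IsProbabilityMeasure (M.rootedGraphLaw N) := by
    unfold PoissonEnsemble.rootedGraphLaw; infer_instance
  conv_lhs => rw [hS]
  rw [measureReal_iUnion_fintype]
  · rw [Finset.sum_div]
    refine Finset.sum_congr rfl fun r _ => ?_
    unfold PoissonEnsemble.rootedGraphLaw
    rw [measureReal_prod_prod, measureReal_def _ {r}, hu]
    simp [div_eq_mul_inv]
  · intro r r' hrr
    refine Set.disjoint_left.2 ?_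
    rintro ⟨g, s⟩ ⟨-, h1⟩ ⟨-, h2⟩
    exact hrr (h1.symm.trans h2)
  · intro r
    exact MeasurableSet.of_discrete

end GraphLaw

section Uniformity

variable {X C T : Type*}

theorem integrable_graphLaw_of_bound [Finite C] (M : PoissonEnsemble X C) {N : ℕ}
    (f : (Sym2 (Fin N) → List C) → ℝ) (B : ℝ)
    (h : ∀ g, |f g| ≤ B) : Integrable f (M.graphLaw N) :=
  Integrable.of_bound (Measurable.of_discrete.aestronglyMeasurable) B
    (ae_of_all _ fun g => by simpa using h g)

variable [Fintype X]

theorem LabeledMultigraph.gibbs_nonneg {V : Type*} [Fintype V] (G : LabeledMultigraph V C)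
    (ψ : C → Sym2 X → ℝ≥0) (x : V → X) : 0 ≤ G.gibbs ψ x :=
  div_nonneg (G.weight_nonneg ψ x) (G.partitionFunction_nonneg ψ)

theorem LabeledMultigraph.sum_gibbs {V : Type*} [Fintype V] [DecidableEq V]
    (G : LabeledMultigraph V C) {ψ : C → Sym2 X → ℝ≥0} (h : 0 < G.partitionFunction ψ) :
    ∑ x, G.gibbs ψ x = 1 := by
  unfold LabeledMultigraph.gibbs
  rw [← Finset.sum_div, ← G.partitionFunction_eq_sum, div_self h.ne']

theorem LabeledMultigraph.gibbs_le_one {V : Type*} [Fintype V] [DecidableEq V]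
    (G : LabeledMultigraph V C) (ψ : C → Sym2 X → ℝ≥0) (x : V → X) : G.gibbs ψ x ≤ 1 := by
  refine div_le_one_of_le₀ ?_ (G.partitionFunction_nonneg ψ)
  rw [G.partitionFunction_eq_sum]
  exact Finset.single_le_sum (fun x _ => G.weight_nonneg ψ x) (Finset.mem_univ x)

variable (M : PoissonEnsemble X C)

theorem typeSecondMoment_eq_integral (N : ℕ) (a : X) : M.typeSecondMoment N a
    = ∫ g, defectSecondMoment ((multigraphOfLists N g).gibbs M.ψ) a ∂(M.graphLaw N) := rfl

/-- The model is defined, and the law of the values at the vertices `j` is not uniform up to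
`θ`. -/
def nonuniformEvent [Fintype T] (θ : ℝ) {N : ℕ} (j : T → Fin N) : Set (Sym2 (Fin N) → List C) :=
  {g | 0 < (multigraphOfLists N g).partitionFunction M.ψ ∧
    ∃ ξ, θ ≤ |localMarginal ((multigraphOfLists N g).gibbs M.ψ) j ξ
      - (1 / (Fintype.card X : ℝ)) ^ Fintype.card T|}

open Classical in
theorem card_nonuniform_le [Nonempty X] [Fintype T] [DecidableEq T] {N : ℕ} (hN : N ≠ 0) {θ η : ℝ}
    (hθ : 0 < θ) (g : Sym2 (Fin N) → List C) :
    (∑ j : T → Fin N, if g ∈ nonuniformEvent M θ j then (1 : ℝ) else 0)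
      / (N : ℝ) ^ Fintype.card T
      ≤ ∑ a, (if η ≤ defectSecondMoment ((multigraphOfLists N g).gibbs M.ψ) a then (1 : ℝ) else 0)
        + (Fintype.card (T → X) : ℝ) * (Fintype.card T * (√η + 4 * √√η)) / θ ^ 2 := by
  have hN' : (0 : ℝ) < N := by exact_mod_cast Nat.pos_of_ne_zero hN
  set p := (multigraphOfLists N g).gibbs M.ψ
  set c : ℝ := (1 / (Fintype.card X : ℝ)) ^ Fintype.card T with hc
  have hs0 : ∀ a, (0 : ℝ) ≤ if η ≤ defectSecondMoment p a then (1 : ℝ) else 0 := fun a => by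
    split_ifs <;> norm_num
  have hr0 : (0 : ℝ) ≤ (Fintype.card (T → X) : ℝ) * (Fintype.card T * (√η + 4 * √√η)) / θ ^ 2 := by
    positivity
  by_cases hZ : 0 < (multigraphOfLists N g).partitionFunction M.ψ
  swap
  · have : ∀ j : T → Fin N, g ∉ nonuniformEvent M θ j := fun j hj => hZ hj.1
    simp only [this, if_false, Finset.sum_const_zero, zero_div]
    exact add_nonneg (Finset.sum_nonneg fun a _ => hs0 a) hr0
  by_cases hm : ∃ a, η ≤ defectSecondMoment p a
  · obtain ⟨a, ha⟩ := hm
    have h1 : (1 : ℝ) ≤ ∑ a, if η ≤ defectSecondMoment p a then (1 : ℝ) else 0 := by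
      have := Finset.single_le_sum (fun a _ => hs0 a) (Finset.mem_univ a)
      rwa [if_pos ha] at this
    have h2 : (∑ j : T → Fin N, if g ∈ nonuniformEvent M θ j then (1 : ℝ) else 0)
        / (N : ℝ) ^ Fintype.card T ≤ 1 := by
      refine div_le_one_of_le₀ ?_ (by positivity)
      calc _ ≤ ∑ _j : T → Fin N, (1 : ℝ) :=
            Finset.sum_le_sum fun j _ => by split_ifs <;> norm_num
        _ = _ := by simp
    linarith
  · push Not at hm
    have hstep : ∀ j : T → Fin N, (if g ∈ nonuniformEvent M θ j then (1 : ℝ) else 0)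
        ≤ ∑ ξ : T → X, (localMarginal p j ξ - c) ^ 2 / θ ^ 2 := by
      intro j
      split_ifs with hj
      · obtain ⟨-, ξ, hξ⟩ := hj
        refine le_trans ?_ (Finset.single_le_sum (fun ξ _ => by positivity) (Finset.mem_univ ξ))
        rw [one_le_div (by positivity), ← sq_abs (_ - _)]
        exact pow_le_pow_left₀ hθ.le hξ 2
      · exact Finset.sum_nonneg fun ξ _ => by positivity
    have hbound : ∀ ξ : T → X, (∑ j : T → Fin N, (localMarginal p j ξ - c) ^ 2)
        / (N : ℝ) ^ Fintype.card T ≤ Fintype.card T * (√η + 4 * √√η) := by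
      intro ξ
      refine (sum_localMarginal_sub_sq_le hN p (LabeledMultigraph.gibbs_nonneg _ _)
        (LabeledMultigraph.sum_gibbs _ hZ) ξ).trans ?_
      rw [← nsmul_eq_mul, ← Finset.card_univ, ← Finset.sum_const]
      refine Finset.sum_le_sum fun u _ => ?_
      have := Real.sqrt_le_sqrt (hm (ξ u)).le
      have := Real.sqrt_le_sqrt this
      linarith
    calc _ ≤ (∑ j : T → Fin N, ∑ ξ : T → X, (localMarginal p j ξ - c) ^ 2 / θ ^ 2)
          / (N : ℝ) ^ Fintype.card T := by
          gcongr with j _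
          exact hstep j
      _ = (∑ ξ : T → X, (∑ j : T → Fin N, (localMarginal p j ξ - c) ^ 2)
          / (N : ℝ) ^ Fintype.card T) / θ ^ 2 := by
          rw [Finset.sum_comm]
          simp only [← Finset.sum_div]
          rw [div_right_comm]
      _ ≤ (∑ _ξ : T → X, (Fintype.card T * (√η + 4 * √√η))) / θ ^ 2 := by
          gcongr with ξ _
          exact hbound ξ
      _ = (Fintype.card (T → X) : ℝ) * (Fintype.card T * (√η + 4 * √√η)) / θ ^ 2 := by
          rw [Finset.sum_const, Finset.card_univ, nsmul_eq_mul]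
      _ ≤ _ := le_add_of_nonneg_left (Finset.sum_nonneg fun a _ => hs0 a)

variable [Finite C]

theorem mul_measureReal_le_typeSecondMoment (N : ℕ) (a : X) (η : ℝ) :
    η * (M.graphLaw N).real {g | η ≤ defectSecondMoment ((multigraphOfLists N g).gibbs M.ψ) a}
      ≤ M.typeSecondMoment N a := by
  have hnn : ∀ g, 0 ≤ defectSecondMoment ((multigraphOfLists N g).gibbs M.ψ) a := fun g =>
    Finset.sum_nonneg fun x _ => Finset.sum_nonneg fun y _ =>
      mul_nonneg (mul_nonneg (LabeledMultigraph.gibbs_nonneg _ _ _)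
        (LabeledMultigraph.gibbs_nonneg _ _ _)) (sq_nonneg _)
  rw [typeSecondMoment_eq_integral]
  refine mul_meas_ge_le_integral_of_nonneg (ae_of_all _ hnn) ?_ η
  refine integrable_graphLaw_of_bound M _
    (∑ x₁ : Fin N → X, ∑ x₂ : Fin N → X, 1 * 1 * typeDefect x₁ x₂ a ^ 2) fun g => ?_
  rw [abs_of_nonneg (hnn g)]
  refine Finset.sum_le_sum fun x _ => Finset.sum_le_sum fun y _ => ?_
  refine mul_le_mul_of_nonneg_right ?_ (sq_nonneg _)
  exact mul_le_mul (LabeledMultigraph.gibbs_le_one _ _ _) (LabeledMultigraph.gibbs_le_one _ _ _)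
    (LabeledMultigraph.gibbs_nonneg _ _ _) zero_le_one

theorem tendsto_sum_nonuniform [Nonempty X] [Fintype T] [DecidableEq T]
    (htype : ∀ a : X, Tendsto (fun N => M.typeSecondMoment N a) atTop (𝓝 0)) {θ : ℝ}
    (hθ : 0 < θ) :
    Tendsto (fun N : ℕ => (∑ j : T → Fin N, (M.graphLaw N).real (nonuniformEvent M θ j))
      / (N : ℝ) ^ Fintype.card T) atTop (𝓝 0) := by
  classical
  have hcont : Tendsto (fun η : ℝ => (Fintype.card (T → X) : ℝ)
      * (Fintype.card T * (√η + 4 * √√η)) / θ ^ 2) (𝓝[>] 0) (𝓝 0) := by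
    have : Continuous fun η : ℝ => (Fintype.card (T → X) : ℝ)
      * (Fintype.card T * (√η + 4 * √√η)) / θ ^ 2 := by fun_prop
    have h := this.tendsto 0
    simp only [Real.sqrt_zero, mul_zero, add_zero, zero_div] at h
    exact h.mono_left nhdsWithin_le_nhds
  rw [Metric.tendsto_atTop']
  intro ε hε
  obtain ⟨η, hηε, hη⟩ := ((hcont.eventually (gt_mem_nhds (half_pos hε))).and
    self_mem_nhdsWithin).exists
  have hη : 0 < η := hη
  have hsum : Tendsto (fun N => (∑ a, M.typeSecondMoment N a) / η) atTop (𝓝 0) := by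
    have := (tendsto_finsetSum Finset.univ fun a _ => htype a).div_const η
    simpa using this
  obtain ⟨N₀, hN₀⟩ := eventually_atTop.1 (hsum.eventually (gt_mem_nhds (half_pos hε)))
  refine ⟨N₀, fun N hN => ?_⟩
  have hN' : N ≠ 0 := by omega
  have hnn : 0 ≤ (∑ j : T → Fin N, (M.graphLaw N).real (nonuniformEvent M θ j))
      / (N : ℝ) ^ Fintype.card T := by positivity
  rw [Real.dist_eq, sub_zero, abs_of_nonneg hnn]
  set K := (Fintype.card (T → X) : ℝ) * (Fintype.card T * (√η + 4 * √√η)) / θ ^ 2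
  have hind : ∀ S : Set (Sym2 (Fin N) → List C),
      (M.graphLaw N).real S = ∫ g, (if g ∈ S then (1 : ℝ) else 0) ∂(M.graphLaw N) := by
    intro S
    rw [← integral_indicator_one (MeasurableSet.of_discrete (s := S))]
    refine integral_congr_ae (ae_of_all _ fun g => ?_)
    simp [Set.indicator_apply]
  have hint : ∀ S : Set (Sym2 (Fin N) → List C),
      Integrable (fun g => if g ∈ S then (1 : ℝ) else 0) (M.graphLaw N) := fun S =>
    integrable_graphLaw_of_bound M _ 1 fun g => by split_ifs <;> simp
  have hint' : Integrable (fun g => ∑ a,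
      (if g ∈ {g | η ≤ defectSecondMoment ((multigraphOfLists N g).gibbs M.ψ) a}
        then (1 : ℝ) else 0)) (M.graphLaw N) :=
    integrable_finsetSum _ fun a _ => hint _
  calc (∑ j : T → Fin N, (M.graphLaw N).real (nonuniformEvent M θ j)) / (N : ℝ) ^ Fintype.card T
      = ∫ g, (∑ j : T → Fin N, if g ∈ nonuniformEvent M θ j then (1 : ℝ) else 0)
          / (N : ℝ) ^ Fintype.card T ∂(M.graphLaw N) := by
        rw [integral_div, integral_finsetSum _ fun j _ => hint _]
        simp only [hind]
    _ ≤ ∫ g, (∑ a, (if g ∈ {g | η ≤ defectSecondMoment ((multigraphOfLists N g).gibbs M.ψ) a}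
          then (1 : ℝ) else 0) + K) ∂(M.graphLaw N) := by
        refine integral_mono ((integrable_finsetSum _ fun j _ => hint _).div_const _)
          (hint'.add (integrable_const _)) fun g => ?_
        exact card_nonuniform_le M hN' hθ g
    _ = ∑ a, (M.graphLaw N).real
          {g | η ≤ defectSecondMoment ((multigraphOfLists N g).gibbs M.ψ) a} + K := by
        rw [integral_add hint' (integrable_const _), integral_finsetSum _ fun a _ => hint _]
        simp only [← hind]
        simp
    _ ≤ (∑ a, M.typeSecondMoment N a) / η + K := by
        rw [Finset.sum_div]
        gcongr with a _
        rw [le_div_iff₀ hη, mul_comm]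
        exact mul_measureReal_le_typeSecondMoment M N a η
    _ < ε := by
        have := hN₀ N hN.le
        linarith

end Uniformity

section Words

variable {C X : Type*}

/-- The depth of a node. -/
def nodeDepth (ω : List ℕ → List C) (ℓ : ℕ) (u : truncatedNodes ω ℓ) : ℕ := u.1.length

theorem isLayered_truncatedTree (ω : List ℕ → List C) (ℓ : ℕ) :
    IsLayered (truncatedTree ω ℓ) (treeRoot ω ℓ) (nodeDepth ω ℓ) ℓ where
  ends_injective := by
    rintro ⟨⟨i, u⟩, h⟩ ⟨⟨j, v⟩, h'⟩ hij
    have hij' : s(u, (⟨i :: u.1, h⟩ : truncatedNodes ω ℓ)) = s(v, ⟨j :: v.1, h'⟩) := hij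
    rw [Sym2.eq_iff] at hij'
    rcases hij' with ⟨rfl, h2⟩ | ⟨h1, h2⟩
    · have := congrArg Subtype.val h2
      simp only [List.cons.injEq, and_true] at this
      subst this
      rfl
    · have e1 := congrArg (fun z : truncatedNodes ω ℓ => z.1.length) h1
      have e2 := congrArg (fun z : truncatedNodes ω ℓ => z.1.length) h2
      simp only [List.length_cons] at e1 e2
      omega
  depth_root := rfl
  depth_le := fun u => u.2.2
  exists_parent := by
    rintro ⟨u, hu⟩
    cases u with
    | nil => exact Or.inl rfl
    | cons i u =>
      exact Or.inr ⟨⟨(i, ⟨u, parent_mem_truncatedNodes hu⟩), hu⟩, ⟨u, parent_mem_truncatedNodes hu⟩,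
        rfl, rfl⟩
  edge_depth := by
    rintro ⟨⟨i, u⟩, h⟩
    exact ⟨u, ⟨i :: u.1, h⟩, rfl, rfl⟩

theorem card_truncatedNodes (ω : List ℕ → List C) (ℓ : ℕ) :
    Fintype.card (truncatedNodes ω ℓ) = Fintype.card (truncatedTree ω ℓ).Edge + 1 := by
  rw [← Fintype.card_option]
  symm
  refine Fintype.card_of_bijective (f := fun k : Option (truncatedTree ω ℓ).Edge =>
    k.elim (treeRoot ω ℓ) fun k => ⟨k.1.1 :: k.1.2.1, k.2⟩) ⟨?_, ?_⟩
  · rintro (_ | ⟨⟨i, u⟩, h⟩) (_ | ⟨⟨j, v⟩, h'⟩) hk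
    · rfl
    · exact absurd (congrArg Subtype.val hk) (List.cons_ne_nil _ _).symm
    · exact absurd (congrArg Subtype.val hk) (List.cons_ne_nil _ _)
    · have := congrArg Subtype.val hk
      simp only [Option.elim, List.cons.injEq] at this
      obtain ⟨rfl, h2⟩ := this
      have h2 := Subtype.ext h2
      subst h2
      rfl
  · rintro ⟨u, hu⟩
    cases u with
    | nil => exact ⟨none, rfl⟩
    | cons i u => exact ⟨some ⟨(i, ⟨u, parent_mem_truncatedNodes hu⟩), hu⟩, rfl⟩

/-- The nodes which have their children in the truncated tree. -/
abbrev InnerNode (ω : List ℕ → List C) (ℓ : ℕ) := innerSet (nodeDepth ω ℓ) ℓ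

theorem cons_mem_truncatedNodes {ω : List ℕ → List C} {ℓ : ℕ} (u : InnerNode ω ℓ) {i : ℕ}
    (hi : i < (ω u.1.1).length) : i :: u.1.1 ∈ truncatedNodes ω ℓ :=
  ⟨⟨u.1.2.1, hi⟩, u.2⟩

/-- The child number `i` of an inner node. -/
def childNode {ω : List ℕ → List C} {ℓ : ℕ} (u : InnerNode ω ℓ) (i : Fin (ω u.1.1).length) :
    truncatedNodes ω ℓ := ⟨i :: u.1.1, cons_mem_truncatedNodes u i.2⟩

open Classical in
theorem prod_label_truncatedTree (ω : List ℕ → List C) (ℓ : ℕ) (f : C → ℝ) :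
    ∏ k, f ((truncatedTree ω ℓ).label k)
      = ∏ u : InnerNode ω ℓ, ((ω u.1.1).map f).prod := by
  have : ∀ u : InnerNode ω ℓ, ((ω u.1.1).map f).prod
      = ∏ i : Fin (ω u.1.1).length, f ((ω u.1.1).get i) := by
    intro u
    rw [← List.prod_ofFn]
    congr 1
    conv_lhs => rw [← List.ofFn_get (ω u.1.1), List.map_ofFn]
    rfl
  simp only [this]
  rw [← Fintype.prod_sigma (fun k : (Σ u : InnerNode ω ℓ, Fin (ω u.1.1).length) =>
    f ((ω k.1.1.1).get k.2))]
  let e : (truncatedTree ω ℓ).Edge ≃ Σ u : InnerNode ω ℓ, Fin (ω u.1.1).length :=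
    { toFun := fun k => ⟨⟨k.1.2, k.2.2⟩, ⟨k.1.1, k.2.1.2⟩⟩
      invFun := fun z => ⟨(z.2, z.1.1), cons_mem_truncatedNodes z.1 z.2.2⟩
      left_inv := fun _ => rfl
      right_inv := fun _ => rfl }
  exact Fintype.prod_equiv e _ _ fun k => rfl

/-- An injective map of the nodes to vertices which respects the order of siblings. -/
structure IsIncreasing {ω : List ℕ → List C} {ℓ N : ℕ} (ι : truncatedNodes ω ℓ → Fin N) :
    Prop where
  injective : Function.Injective ι
  strictMono : ∀ u : InnerNode ω ℓ, StrictMono fun i => ι (childNode u i)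

/-- Permute the children of every node (this is not an automorphism of the tree). -/
def permuteSiblings {ω : List ℕ → List C} {ℓ : ℕ}
    (σ : ∀ u : InnerNode ω ℓ, Equiv.Perm (Fin (ω u.1.1).length)) :
    truncatedNodes ω ℓ → truncatedNodes ω ℓ
  | ⟨[], h⟩ => ⟨[], h⟩
  | ⟨i :: u, h⟩ => childNode (⟨⟨u, parent_mem_truncatedNodes h⟩, h.2⟩ : InnerNode ω ℓ)
      (σ ⟨⟨u, parent_mem_truncatedNodes h⟩, h.2⟩ ⟨i, h.1.2⟩)

theorem permuteSiblings_childNode {ω : List ℕ → List C} {ℓ : ℕ}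
    (σ : ∀ u : InnerNode ω ℓ, Equiv.Perm (Fin (ω u.1.1).length)) (u : InnerNode ω ℓ)
    (i : Fin (ω u.1.1).length) :
    permuteSiblings σ (childNode u i) = childNode u (σ u i) := rfl

theorem permuteSiblings_symm {ω : List ℕ → List C} {ℓ : ℕ}
    (σ : ∀ u : InnerNode ω ℓ, Equiv.Perm (Fin (ω u.1.1).length)) (v : truncatedNodes ω ℓ) :
    permuteSiblings σ (permuteSiblings (fun u => (σ u).symm) v) = v := by
  obtain ⟨v, hv⟩ := v
  cases v with
  | nil => rfl
  | cons i u =>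
    let u' : InnerNode ω ℓ := ⟨⟨u, parent_mem_truncatedNodes hv⟩, hv.2⟩
    change permuteSiblings σ (childNode u' ((σ u').symm ⟨i, hv.1.2⟩)) = _
    rw [permuteSiblings_childNode, Equiv.apply_symm_apply]
    rfl

theorem permuteSiblings_surjective {ω : List ℕ → List C} {ℓ : ℕ}
    (σ : ∀ u : InnerNode ω ℓ, Equiv.Perm (Fin (ω u.1.1).length)) :
    Function.Surjective (permuteSiblings σ) :=
  fun v => ⟨_, permuteSiblings_symm σ v⟩

open Classical in
theorem descFactorial_le_card_isIncreasing (ω : List ℕ → List C) (ℓ N : ℕ) :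
    N.descFactorial (Fintype.card (truncatedNodes ω ℓ))
      ≤ Fintype.card {ι : truncatedNodes ω ℓ → Fin N // IsIncreasing ι}
        * ∏ u : InnerNode ω ℓ, ((ω u.1.1).length).factorial := by
  have h1 : N.descFactorial (Fintype.card (truncatedNodes ω ℓ))
      = Fintype.card (truncatedNodes ω ℓ ↪ Fin N) := by
    rw [Fintype.card_embedding_eq, Fintype.card_fin]
  have h2 : ∏ u : InnerNode ω ℓ, ((ω u.1.1).length).factorial
      = Fintype.card (∀ u : InnerNode ω ℓ, Equiv.Perm (Fin (ω u.1.1).length)) := by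
    rw [Fintype.card_pi]
    simp only [Fintype.card_perm, Fintype.card_fin]
  rw [h1, h2, ← Fintype.card_prod]
  let σ : (truncatedNodes ω ℓ ↪ Fin N) →
      ∀ u : InnerNode ω ℓ, Equiv.Perm (Fin (ω u.1.1).length) :=
    fun ι u => Tuple.sort fun i => ι (childNode u i)
  have hσ : ∀ ι : truncatedNodes ω ℓ ↪ Fin N, IsIncreasing (ι ∘ permuteSiblings (σ ι)) := by
    intro ι
    refine ⟨ι.injective.comp (Finite.injective_iff_surjective.2 (permuteSiblings_surjective _)),
      fun u => ?_⟩
    have hm : Monotone ((fun i => ι (childNode u i)) ∘ Tuple.sort fun i => ι (childNode u i)) :=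
      Tuple.monotone_sort _
    refine hm.strictMono_of_injective ?_
    refine Function.Injective.comp ?_ (Equiv.injective _)
    intro i j hij
    have := congrArg Subtype.val (ι.injective hij)
    simpa [childNode, Fin.ext_iff] using this
  refine Fintype.card_le_of_injective
    (fun ι => (⟨ι ∘ permuteSiblings (σ ι), hσ ι⟩, σ ι)) ?_
  intro ι ι' h
  simp only [Prod.mk.injEq, Subtype.mk.injEq] at h
  obtain ⟨h1, h2⟩ := h
  rw [h2] at h1
  exact DFunLike.coe_injective ((permuteSiblings_surjective (σ ι')).injective_comp_right h1)

theorem eq_of_strictMono_of_range_eq {α : Type*} [LinearOrder α] {k k' : ℕ} {f : Fin k → α}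
    {f' : Fin k' → α} (hf : StrictMono f) (hf' : StrictMono f') (h : Set.range f = Set.range f') :
    k = k' ∧ ∀ i (hi : i < k) (hi' : i < k'), f ⟨i, hi⟩ = f' ⟨i, hi'⟩ := by
  have hk : k = k' := by
    have h1 := Set.ncard_range_of_injective hf.injective
    have h2 := Set.ncard_range_of_injective hf'.injective
    rw [h, h2] at h1
    simpa using h1.symm
  subst hk
  refine ⟨rfl, fun i _ _ => ?_⟩
  rw [(hf.range_inj hf').1 h]

/-- The event that the truncated tree is planted. -/
abbrev plantedTreeEvent {V : Type*} (ω : List ℕ → List C) (ℓ : ℕ) (ι : truncatedNodes ω ℓ → V) :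
    Set (Sym2 V → List C) :=
  plantedEvent (truncatedTree ω ℓ) (innerSet (nodeDepth ω ℓ) ℓ) ι

section Unique

variable {N : ℕ} {g : Sym2 (Fin N) → List C} {ω ω' : List ℕ → List C} {ℓ : ℕ}
  {ι : truncatedNodes ω ℓ → Fin N} {ι' : truncatedNodes ω' ℓ → Fin N}

theorem planted_child_label (hι : Function.Injective ι) (hg : g ∈ plantedTreeEvent ω ℓ ι)
    (u : InnerNode ω ℓ) (i : Fin (ω u.1.1).length) :
    g s(ι u, ι (childNode u i)) = [(ω u.1.1).get i] := by
  let k : (truncatedTree ω ℓ).Edge := ⟨(i, u.1), cons_mem_truncatedNodes u i.2⟩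
  have hL := isLayered_truncatedTree ω ℓ
  have := hg _ (hL.map_ends_mem_touching ι k)
  rw [plantedLists_map_ends hL.ends_injective hι] at this
  exact this

theorem planted_neighbours (hι : Function.Injective ι) (hg : g ∈ plantedTreeEvent ω ℓ ι)
    (u : InnerNode ω ℓ) :
    Set.range (fun i => ι (childNode u i)) = {w | g s(ι u, w) ≠ [] ∧
      ∀ i p (h : i :: p ∈ truncatedNodes ω ℓ), i :: p = u.1.1 →
        w ≠ ι ⟨p, parent_mem_truncatedNodes h⟩} := by
  ext w
  simp only [Set.mem_range, Set.mem_ofPred_eq]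
  constructor
  · rintro ⟨i, rfl⟩
    refine ⟨?_, ?_⟩
    · rw [planted_child_label hι hg]
      exact List.cons_ne_nil _ _
    · intro j p h hp heq
      have h1 := congrArg (fun z : truncatedNodes ω ℓ => z.1.length) (hι heq)
      have h2 := congrArg List.length hp
      simp only [childNode, List.length_cons] at h1 h2
      omega
  · rintro ⟨hne, hpar⟩
    rw [hg _ ⟨u, u.2, Sym2.mem_mk_left _ _⟩] at hne
    obtain ⟨⟨⟨i, p⟩, hk⟩, hke⟩ := exists_of_plantedLists_ne_nil hne
    have hke' : s(ι p, ι ⟨i :: p.1, hk⟩) = s(ι u, w) := hke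
    rw [Sym2.eq_iff] at hke'
    rcases hke' with ⟨h1, rfl⟩ | ⟨rfl, h2⟩
    · have h1 := hι h1
      subst h1
      exact ⟨⟨i, hk.1.2⟩, rfl⟩
    · exact absurd rfl (hpar i p.1 hk (congrArg Subtype.val (hι h2)))

theorem planted_unique_children (hι : IsIncreasing ι) (hι' : IsIncreasing ι')
    (hg : g ∈ plantedTreeEvent ω ℓ ι) (hg' : g ∈ plantedTreeEvent ω' ℓ ι')
    (u : InnerNode ω ℓ) (u' : InnerNode ω' ℓ) (huu : u.1.1 = u'.1.1) (hu : ι u = ι' u')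
    (hpar : ∀ i p (h : i :: p ∈ truncatedNodes ω ℓ) (h' : i :: p ∈ truncatedNodes ω' ℓ),
      i :: p = u.1.1 →
        ι ⟨p, parent_mem_truncatedNodes h⟩ = ι' ⟨p, parent_mem_truncatedNodes h'⟩) :
    ω u.1.1 = ω' u.1.1 ∧ ∀ i (hi : i :: u.1.1 ∈ truncatedNodes ω ℓ)
      (hi' : i :: u.1.1 ∈ truncatedNodes ω' ℓ), ι ⟨i :: u.1.1, hi⟩ = ι' ⟨i :: u.1.1, hi'⟩ := by
  have hr : Set.range (fun i => ι (childNode u i)) = Set.range (fun i => ι' (childNode u' i)) := by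
    rw [planted_neighbours hι.injective hg, planted_neighbours hι'.injective hg']
    ext w
    simp only [Set.mem_ofPred_eq, hu]
    refine and_congr_right fun _ => ⟨fun h i p hp hip => ?_, fun h i p hp hip => ?_⟩
    · have hp0 : i :: p ∈ truncatedNodes ω ℓ := by rw [hip, ← huu]; exact u.1.2
      rw [← hpar i p hp0 hp (hip.trans huu.symm)]
      exact h i p hp0 (hip.trans huu.symm)
    · have hp0 : i :: p ∈ truncatedNodes ω' ℓ := by rw [hip, huu]; exact u'.1.2
      rw [hpar i p hp hp0 hip]
      exact h i p hp0 (hip.trans huu)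
  obtain ⟨hk, hf⟩ := eq_of_strictMono_of_range_eq (hι.strictMono u) (hι'.strictMono u') hr
  have hchild : ∀ i (hi : i :: u.1.1 ∈ truncatedNodes ω ℓ)
      (hi' : i :: u.1.1 ∈ truncatedNodes ω' ℓ), ι ⟨i :: u.1.1, hi⟩ = ι' ⟨i :: u.1.1, hi'⟩ := by
    intro i hi hi'
    have h1 := hf i hi.1.2 (by rw [← huu]; exact hi'.1.2)
    refine h1.trans (congrArg ι' (Subtype.ext ?_))
    simp [childNode, huu]
  refine ⟨?_, hchild⟩
  rw [huu] at hk ⊢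
  refine List.ext_getElem (by rw [← huu] at hk ⊢; rw [hk, huu]) fun i h1 h2 => ?_
  have h1' : i < (ω u.1.1).length := by rw [huu]; exact h1
  have e1 := planted_child_label hι.injective hg u ⟨i, h1'⟩
  have e2 := planted_child_label hι'.injective hg' u' ⟨i, h2⟩
  rw [hu, hf i h1' h2, e2] at e1
  have := (List.cons.inj e1).1
  simp only [List.get_eq_getElem] at this
  rw [this]
  congr 1
  rw [huu]

theorem planted_unique (hι : IsIncreasing ι) (hι' : IsIncreasing ι')
    (hg : g ∈ plantedTreeEvent ω ℓ ι) (hg' : g ∈ plantedTreeEvent ω' ℓ ι')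
    (hroot : ι (treeRoot ω ℓ) = ι' (treeRoot ω' ℓ)) (u : List ℕ) (hu : u ∈ truncatedNodes ω ℓ) :
    ∃ hu' : u ∈ truncatedNodes ω' ℓ, ι ⟨u, hu⟩ = ι' ⟨u, hu'⟩ ∧ (u.length < ℓ → ω u = ω' u ∧
      ∀ i (hi : i :: u ∈ truncatedNodes ω ℓ) (hi' : i :: u ∈ truncatedNodes ω' ℓ),
        ι ⟨i :: u, hi⟩ = ι' ⟨i :: u, hi'⟩) := by
  induction u with
  | nil =>
    refine ⟨nil_mem_truncatedNodes ω' ℓ, hroot, fun hl => ?_⟩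
    exact planted_unique_children hι hι' hg hg' ⟨treeRoot ω ℓ, hl⟩ ⟨treeRoot ω' ℓ, hl⟩ rfl hroot
      fun i p _ _ hip => absurd hip (List.cons_ne_nil _ _)
  | cons i u ih =>
    obtain ⟨hu₁, h1, h2⟩ := ih (parent_mem_truncatedNodes hu)
    obtain ⟨h3, h4⟩ := h2 hu.2
    have hu' : i :: u ∈ truncatedNodes ω' ℓ := ⟨⟨hu₁.1, h3 ▸ hu.1.2⟩, hu.2⟩
    refine ⟨hu', h4 i hu hu', fun hl => ?_⟩
    refine planted_unique_children hι hι' hg hg' ⟨⟨i :: u, hu⟩, hl⟩ ⟨⟨i :: u, hu'⟩, hl⟩ rfl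
      (h4 i hu hu') fun j p _ _ hjp => ?_
    obtain ⟨rfl, rfl⟩ := List.cons.inj hjp
    exact h1

end Unique

/-- The trees with the same truncation at depth `ℓ` as `ω`. -/
def treeCylinder (ω : List ℕ → List C) (ℓ : ℕ) : Set (List ℕ → List C) :=
  {ω' | ∀ u ∈ truncatedNodes ω ℓ, u.length < ℓ → ω' u = ω u}

theorem truncatedNodes_eq_of_mem_treeCylinder {ω ω' : List ℕ → List C} {ℓ : ℕ}
    (h : ω' ∈ treeCylinder ω ℓ) : truncatedNodes ω' ℓ = truncatedNodes ω ℓ := by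
  ext u
  induction u with
  | nil => exact ⟨fun _ => nil_mem_truncatedNodes _ _, fun _ => nil_mem_truncatedNodes _ _⟩
  | cons i u ih =>
    constructor
    · intro hu
      have hp := ih.1 (parent_mem_truncatedNodes hu)
      exact ⟨⟨hp.1, h u hp hu.2 ▸ hu.1.2⟩, hu.2⟩
    · intro hu
      have hp := parent_mem_truncatedNodes hu
      exact ⟨⟨(ih.2 hp).1, (h u hp hu.2).symm ▸ hu.1.2⟩, hu.2⟩

/-- The lists of labels at the nodes of depth less than `ℓ`. -/
noncomputable def treeCode (ω : List ℕ → List C) (ℓ : ℕ) : Finset (List ℕ × List C) := by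
  classical
  exact ((truncatedNodes_finite ω ℓ).toFinset.filter fun u => u.length < ℓ).image fun u => (u, ω u)

theorem mem_treeCode {ω : List ℕ → List C} {ℓ : ℕ} {z : List ℕ × List C} :
    z ∈ treeCode ω ℓ ↔ z.1 ∈ truncatedNodes ω ℓ ∧ z.1.length < ℓ ∧ z.2 = ω z.1 := by
  classical
  obtain ⟨u, l⟩ := z
  simp only [treeCode, Finset.mem_image, Finset.mem_filter, Set.Finite.mem_toFinset,
    Prod.mk.injEq]
  constructor
  · rintro ⟨u', ⟨h1, h2⟩, rfl, rfl⟩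
    exact ⟨h1, h2, rfl⟩
  · rintro ⟨h1, h2, rfl⟩
    exact ⟨u, ⟨h1, h2⟩, rfl, rfl⟩

theorem treeCode_eq_iff {ω ω' : List ℕ → List C} {ℓ : ℕ} :
    treeCode ω' ℓ = treeCode ω ℓ ↔ ω' ∈ treeCylinder ω ℓ := by
  constructor
  · intro h u hu hl
    have : (u, ω u) ∈ treeCode ω' ℓ := by
      rw [h]; exact mem_treeCode.2 ⟨hu, hl, rfl⟩
    exact (mem_treeCode.1 this).2.2.symm
  · intro h
    ext ⟨u, l⟩
    rw [mem_treeCode, mem_treeCode, truncatedNodes_eq_of_mem_treeCylinder h]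
    refine and_congr_right fun hu => and_congr_right fun hl => ?_
    rw [h u hu hl]

theorem IsIncreasing.treeCode_eq {N : ℕ} {g : Sym2 (Fin N) → List C} {ω ω' : List ℕ → List C}
    {ℓ : ℕ} {ι : truncatedNodes ω ℓ → Fin N} {ι' : truncatedNodes ω' ℓ → Fin N}
    (hι : IsIncreasing ι) (hι' : IsIncreasing ι')
    (hg : g ∈ plantedTreeEvent ω ℓ ι) (hg' : g ∈ plantedTreeEvent ω' ℓ ι')
    (hroot : ι (treeRoot ω ℓ) = ι' (treeRoot ω' ℓ)) : treeCode ω ℓ = treeCode ω' ℓ := by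
  rw [eq_comm, treeCode_eq_iff]
  intro u hu hl
  obtain ⟨_, -, h⟩ := planted_unique hι hι' hg hg' hroot u hu
  exact (h hl).1.symm

theorem IsIncreasing.eq_of_root_eq {N : ℕ} {g : Sym2 (Fin N) → List C} {ω : List ℕ → List C}
    {ℓ : ℕ} {ι ι' : truncatedNodes ω ℓ → Fin N} (hι : IsIncreasing ι) (hι' : IsIncreasing ι')
    (hg : g ∈ plantedTreeEvent ω ℓ ι) (hg' : g ∈ plantedTreeEvent ω ℓ ι')
    (hroot : ι (treeRoot ω ℓ) = ι' (treeRoot ω ℓ)) : ι = ι' := by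
  funext u
  obtain ⟨_, h, -⟩ := planted_unique hι hι' hg hg' hroot u.1 u.2
  exact h

/-- The multigraph whose edges join the nodes of a finite set of words to their children. -/
noncomputable def wordGraph (S : Set (List ℕ)) (hS : S.Finite)
    (lab : {e : ℕ × S // e.1 :: e.2.1 ∈ S} → C) : LabeledMultigraph S C where
  Edge := {e : ℕ × S // e.1 :: e.2.1 ∈ S}
  edgeFintype := by
    have : Fintype S := hS.fintype
    have : Finite {e : ℕ × S // e.1 :: e.2.1 ∈ S} := by
      refine Finite.of_injective (β := S) (fun e => ⟨e.1.1 :: e.1.2.1, e.2⟩) ?_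
      rintro ⟨⟨i, u, hu⟩, h⟩ ⟨⟨j, v, hv⟩, h'⟩ hij
      simpa using hij
    exact Fintype.ofFinite _
  ends := fun e => s(e.1.2, ⟨e.1.1 :: e.1.2.1, e.2⟩)
  label := lab

theorem rootCorrelation_wordGraph_congr [Fintype X] (ψ : C → Sym2 X → ℝ≥0) {S S' : Set (List ℕ)}
    (h : S = S') (hS : S.Finite) (hS' : S'.Finite) [Fintype S] [Fintype S'] (h0 : [] ∈ S)
    (h0' : [] ∈ S')
    (lab : {e : ℕ × S // e.1 :: e.2.1 ∈ S} → C) (lab' : {e : ℕ × S' // e.1 :: e.2.1 ∈ S'} → C)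
    (hlab : ∀ i u hu hu' hi hi', lab ⟨(i, ⟨u, hu⟩), hi⟩ = lab' ⟨(i, ⟨u, hu'⟩), hi'⟩) (t : ℕ) :
    (wordGraph S hS lab).rootCorrelation ψ ⟨[], h0⟩ t
      = (wordGraph S' hS' lab').rootCorrelation ψ ⟨[], h0'⟩ t := by
  subst h
  have : lab = lab' := by
    funext ⟨⟨i, u, hu⟩, hi⟩
    exact hlab i u hu hu hi hi
  subst this
  congr!

theorem rootCorrelation_eq_of_mem_treeCylinder [Fintype X] (ψ : C → Sym2 X → ℝ≥0)
    {ω ω' : List ℕ → List C} {ℓ : ℕ} (h : ω' ∈ treeCylinder ω ℓ) (t : ℕ) :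
    (truncatedTree ω' ℓ).rootCorrelation ψ (treeRoot ω' ℓ) t
      = (truncatedTree ω ℓ).rootCorrelation ψ (treeRoot ω ℓ) t := by
  refine rootCorrelation_wordGraph_congr ψ (truncatedNodes_eq_of_mem_treeCylinder h)
    (truncatedNodes_finite _ _) (truncatedNodes_finite _ _) (nil_mem_truncatedNodes _ _)
    (nil_mem_truncatedNodes _ _) (fun e => (ω' e.1.2.1).get ⟨e.1.1, e.2.1.2⟩)
    (fun e => (ω e.1.2.1).get ⟨e.1.1, e.2.1.2⟩) ?_ t
  intro i u hu hu' hi hi'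
  have := h u hu' hi'.2
  simp only [List.get_eq_getElem]
  congr 1

variable (M : PoissonEnsemble X C)

instance isProbabilityMeasure_treeLaw : IsProbabilityMeasure M.treeLaw := by
  unfold PoissonEnsemble.treeLaw; infer_instance

theorem treeCylinder_eq_pi (ω : List ℕ → List C) (ℓ : ℕ) : treeCylinder ω ℓ
    = (((truncatedNodes_finite ω ℓ).toFinset.filter fun u => u.length < ℓ : Finset (List ℕ)) :
      Set (List ℕ)).pi fun u => {ω u} := by
  ext ω'
  simp [treeCylinder, Set.mem_pi]

theorem measurableSet_treeCylinder (ω : List ℕ → List C) (ℓ : ℕ) :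
    MeasurableSet (treeCylinder ω ℓ) := by
  rw [treeCylinder_eq_pi]
  exact MeasurableSet.pi (Finset.countable_toSet _) fun u _ => measurableSet_list _

open Classical in
theorem treeLaw_real_treeCylinder (ω : List ℕ → List C) (ℓ : ℕ) :
    M.treeLaw.real (treeCylinder ω ℓ)
      = ∏ u : InnerNode ω ℓ, (poissonList (2 * M.γ) M.p).toMeasure.real {ω u.1.1} := by
  rw [treeCylinder_eq_pi, measureReal_def, PoissonEnsemble.treeLaw,
    Measure.infinitePi_pi _ fun _ _ => measurableSet_list _, ENNReal.toReal_prod]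
  symm
  refine Finset.prod_bij (fun u _ => u.1.1) ?_ ?_ ?_ ?_
  · intro u _
    simp only [Finset.mem_filter, Set.Finite.mem_toFinset]
    exact ⟨u.1.2, u.2⟩
  · intro u _ v _ huv
    exact Subtype.ext (Subtype.ext huv)
  · intro u hu
    simp only [Finset.mem_filter, Set.Finite.mem_toFinset] at hu
    exact ⟨⟨⟨u, hu.1⟩, hu.2⟩, Finset.mem_univ _, rfl⟩
  · intro u _
    rfl

end Words

section Solvability

variable {X C : Type*} (M : PoissonEnsemble X C)

open Classical in
theorem treeLaw_mul_descFactorial_le [Finite C] (ω : List ℕ → List C) (ℓ : ℕ) {N : ℕ}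
    (hN : N ≠ 0) :
    M.treeLaw.real (treeCylinder ω ℓ) * ((N.descFactorial (Fintype.card (truncatedNodes ω ℓ)) : ℝ)
        / (N : ℝ) ^ Fintype.card (truncatedNodes ω ℓ))
      ≤ (∑ ι : {ι : truncatedNodes ω ℓ → Fin N // IsIncreasing ι},
          (M.graphLaw N).real (plantedTreeEvent ω ℓ ι.1)) / N := by
  have hN' : (0 : ℝ) < N := by exact_mod_cast Nat.pos_of_ne_zero hN
  set E := Fintype.card (truncatedTree ω ℓ).Edge with hE
  set I := innerSet (nodeDepth ω ℓ) ℓ with hI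
  set q : ℝ := Real.exp (-(2 * M.γ)) ^ I.ncard with hq
  set B : ℝ := ∏ k, (2 * M.γ * (M.p ((truncatedTree ω ℓ).label k)).toReal : ℝ) with hB
  set D : ℝ := ∏ u : InnerNode ω ℓ, (((ω u.1.1).length).factorial : ℝ) with hD
  have hB0 : 0 ≤ B := Finset.prod_nonneg fun _ _ => by positivity
  have hq0 : 0 ≤ q := by positivity
  have hD0 : 0 < D := Finset.prod_pos fun _ _ => by positivity
  have hPF : plantingFactor M N (truncatedTree ω ℓ) = B / (N : ℝ) ^ E := by
    unfold plantingFactor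
    rw [hB, hE, ← Finset.card_univ, ← Finset.prod_const, ← Finset.prod_div_distrib]
    exact Finset.prod_congr rfl fun k _ => by ring
  have hI' : I.ncard = Fintype.card (InnerNode ω ℓ) := by
    rw [← Nat.card_coe_set_eq, Nat.card_eq_fintype_card]
  have htree : M.treeLaw.real (treeCylinder ω ℓ) * D = q * B := by
    rw [treeLaw_real_treeCylinder, hD, hq, hB, hI',
      prod_label_truncatedTree ω ℓ fun a => (2 * M.γ * (M.p a).toReal : ℝ), ← Finset.card_univ,
      ← Finset.prod_const, ← Finset.prod_mul_distrib, ← Finset.prod_mul_distrib]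
    refine Finset.prod_congr rfl fun u _ => ?_
    rw [poissonList_real_singleton, List.prod_map_mul, List.map_const', List.prod_replicate]
    push_cast
    field_simp
  have hterm : ∀ ι : {ι : truncatedNodes ω ℓ → Fin N // IsIncreasing ι},
      q * (B / (N : ℝ) ^ E) ≤ (M.graphLaw N).real (plantedTreeEvent ω ℓ ι.1) := by
    intro ι
    rw [(isLayered_truncatedTree ω ℓ).graphLaw_real_plantedEvent M ι.2.injective, hPF]
    refine mul_le_mul_of_nonneg_right ?_ (by positivity)
    exact exp_neg_le_graphLaw_real_isolatedEvent M hN I (Set.toFinite _) ι.1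
  set c := Fintype.card {ι : truncatedNodes ω ℓ → Fin N // IsIncreasing ι}
  have hcard : (N.descFactorial (Fintype.card (truncatedNodes ω ℓ)) : ℝ) ≤ c * D := by
    have := descFactorial_le_card_isIncreasing ω ℓ N
    rw [hD]
    exact_mod_cast this
  rw [card_truncatedNodes, ← hE] at hcard ⊢
  calc _ ≤ M.treeLaw.real (treeCylinder ω ℓ) * ((c * D) / (N : ℝ) ^ (E + 1)) := by gcongr
    _ = c * (q * (B / (N : ℝ) ^ E)) / N := by
        rw [show M.treeLaw.real (treeCylinder ω ℓ) * ((c * D) / (N : ℝ) ^ (E + 1))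
          = c * (M.treeLaw.real (treeCylinder ω ℓ) * D) / (N : ℝ) ^ (E + 1) by ring, htree, pow_succ]
        field_simp
    _ ≤ _ := by
        gcongr
        calc _ = ∑ _ι : {ι : truncatedNodes ω ℓ → Fin N // IsIncreasing ι},
              q * (B / (N : ℝ) ^ E) := by rw [Finset.sum_const, Finset.card_univ, nsmul_eq_mul]
          _ ≤ _ := Finset.sum_le_sum fun ι _ => hterm ι

/-- The truncated tree is planted at the root by an increasing map `ι`, and the event `B ι`
holds. -/
def matchedEvent (ω : List ℕ → List C) (ℓ : ℕ) {N : ℕ}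
    (B : (truncatedNodes ω ℓ → Fin N) → Set (Sym2 (Fin N) → List C)) :
    Set ((Sym2 (Fin N) → List C) × Fin N) :=
  {z | ∃ ι : truncatedNodes ω ℓ → Fin N, IsIncreasing ι ∧ ι (treeRoot ω ℓ) = z.2 ∧
    z.1 ∈ plantedTreeEvent ω ℓ ι ∩ B ι}

open Classical in
theorem rootedGraphLaw_real_matchedEvent [Finite C] (ω : List ℕ → List C) (ℓ : ℕ) {N : ℕ}
    (B : (truncatedNodes ω ℓ → Fin N) → Set (Sym2 (Fin N) → List C)) :
    (M.rootedGraphLaw N).real (matchedEvent ω ℓ B)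
      = (∑ ι : {ι : truncatedNodes ω ℓ → Fin N // IsIncreasing ι},
          (M.graphLaw N).real (plantedTreeEvent ω ℓ ι.1 ∩ B ι.1)) / N := by
  rw [rootedGraphLaw_real]
  congr 1
  rw [← Finset.sum_fiberwise (g := fun ι : {ι : truncatedNodes ω ℓ → Fin N // IsIncreasing ι} =>
    ι.1 (treeRoot ω ℓ))]
  refine Finset.sum_congr rfl fun r _ => ?_
  rw [← measureReal_biUnion_finset]
  · congr 1
    ext g
    simp only [matchedEvent, Set.mem_ofPred_eq, Set.mem_iUnion, Finset.mem_filter, Finset.mem_univ,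
      true_and, Subtype.exists, exists_prop]
  · intro ι hι ι' hι' hne
    refine Set.disjoint_left.2 fun g hg hg' => hne (Subtype.ext ?_)
    simp only [Finset.coe_filter, Finset.mem_univ, true_and, Set.mem_ofPred_eq] at hι hι'
    exact ι.2.eq_of_root_eq ι'.2 hg.1 hg'.1 (hι.trans hι'.symm)
  · intro ι _
    exact MeasurableSet.of_discrete

instance isFiniteMeasure_rootedGraphLaw (N : ℕ) : IsFiniteMeasure (M.rootedGraphLaw N) := by
  unfold PoissonEnsemble.rootedGraphLaw uniformOn
  infer_instance

theorem rootedGraphLaw_real_le_one [Finite C] (N : ℕ)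
    (S : Set ((Sym2 (Fin N) → List C) × Fin N)) : (M.rootedGraphLaw N).real S ≤ 1 := by
  rw [rootedGraphLaw_real]
  refine div_le_one_of_le₀ ?_ (Nat.cast_nonneg _)
  calc _ ≤ ∑ _r : Fin N, (1 : ℝ) := Finset.sum_le_sum fun _ _ => measureReal_le_one
    _ = N := by simp

theorem treeLaw_approx [Finite C] (ℓ : ℕ) (S : Set (List ℕ → List C))
    (hS : ∀ ω ∈ S, treeCylinder ω ℓ ⊆ S) {κ : ℝ} (hκ : 0 < κ) :
    ∃ F : Finset (List ℕ → List C), (∀ ω ∈ F, ω ∈ S) ∧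
      (∀ ω ∈ F, ∀ ω' ∈ F, treeCode ω ℓ = treeCode ω' ℓ → ω = ω') ∧
      M.treeLaw.real S - κ < ∑ ω ∈ F, M.treeLaw.real (treeCylinder ω ℓ) := by
  classical
  let K : Set (Finset (List ℕ × List C)) := (fun ω => treeCode ω ℓ) '' S
  have hK : ∀ c : K, ∃ ω ∈ S, treeCode ω ℓ = c := fun c => c.2
  choose rep hrepS hrep using hK
  have hU : S = ⋃ c : K, treeCylinder (rep c) ℓ := by
    ext ω
    rw [Set.mem_iUnion]
    constructor
    · intro h
      have hc := hrep ⟨treeCode ω ℓ, ω, h, rfl⟩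
      exact ⟨⟨treeCode ω ℓ, ω, h, rfl⟩, treeCode_eq_iff.1 hc.symm⟩
    · rintro ⟨c, hc⟩
      exact hS _ (hrepS c) hc
  have hdisj : Pairwise (Function.onFun Disjoint fun c : K => treeCylinder (rep c) ℓ) := by
    intro c c' hcc
    refine Set.disjoint_left.2 fun ω h h' => hcc (Subtype.ext ?_)
    rw [← hrep c, ← hrep c', ← treeCode_eq_iff.2 h, ← treeCode_eq_iff.2 h']
  have hμ := measure_iUnion (μ := M.treeLaw) hdisj fun c => measurableSet_treeCylinder _ ℓ
  rw [← hU] at hμ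
  have hsum : HasSum (fun c : K => M.treeLaw.real (treeCylinder (rep c) ℓ)) (M.treeLaw.real S) := by
    rw [measureReal_def, hμ, ENNReal.tsum_toReal_eq fun c => measure_ne_top _ _]
    exact ENNReal.hasSum_toReal (by rw [← hμ]; exact measure_ne_top _ _)
  obtain ⟨F, hF⟩ := (hsum.eventually (lt_mem_nhds (sub_lt_self _ hκ))).exists
  have hinj : Function.Injective rep := fun c c' h => Subtype.ext (by rw [← hrep c, ← hrep c', h])
  refine ⟨F.image rep, ?_, ?_, ?_⟩
  · intro ω hω
    obtain ⟨c, -, rfl⟩ := Finset.mem_image.1 hω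
    exact hrepS c
  · intro ω hω ω' hω' h
    obtain ⟨c, -, rfl⟩ := Finset.mem_image.1 hω
    obtain ⟨c', -, rfl⟩ := Finset.mem_image.1 hω'
    rw [hrep, hrep] at h
    rw [Subtype.ext h]
  · rwa [Finset.sum_image fun _ _ _ _ h => hinj h]

theorem tendsto_descFactorial_div_pow (n : ℕ) :
    Tendsto (fun N : ℕ => (N.descFactorial n : ℝ) / (N : ℝ) ^ n) atTop (𝓝 1) := by
  have h := isEquivalent_descFactorial n
  refine (Asymptotics.isEquivalent_iff_tendsto_one ?_).1 h
  filter_upwards [eventually_ne_atTop 0] with N hN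
  simp [hN]

variable [Fintype X]

open Classical in
theorem tendsto_planted_nonuniform [Finite C] [Nonempty X]
    (htype : ∀ a : X, Tendsto (fun N => M.typeSecondMoment N a) atTop (𝓝 0))
    (ω : List ℕ → List C) (ℓ : ℕ) {θ : ℝ} (hθ : 0 < θ) :
    Tendsto (fun N : ℕ => (∑ ι : {ι : truncatedNodes ω ℓ → Fin N // IsIncreasing ι},
      (M.graphLaw N).real (plantedTreeEvent ω ℓ ι.1 ∩
        removeTouching (innerSet (nodeDepth ω ℓ) ℓ) ι.1 ⁻¹' nonuniformEvent M θ ι.1)) / N)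
      atTop (𝓝 0) := by
  have h := (tendsto_sum_nonuniform (T := truncatedNodes ω ℓ) M htype hθ).const_mul
    ((2 * M.γ : ℝ) ^ Fintype.card (truncatedTree ω ℓ).Edge)
  rw [mul_zero] at h
  refine squeeze_zero' (Eventually.of_forall fun N => by positivity) ?_ h
  filter_upwards [eventually_ne_atTop 0] with N hN
  have hN' : (0 : ℝ) < N := by exact_mod_cast Nat.pos_of_ne_zero hN
  set E := Fintype.card (truncatedTree ω ℓ).Edge with hE
  rw [card_truncatedNodes, ← hE]
  calc _ ≤ (∑ ι : {ι : truncatedNodes ω ℓ → Fin N // IsIncreasing ι},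
        (2 * M.γ / N : ℝ) ^ E * (M.graphLaw N).real (nonuniformEvent M θ ι.1)) / N := by
        gcongr with ι _
        refine le_of_eq_of_le ?_ ((isLayered_truncatedTree ω ℓ).graphLaw_real_plantedEvent_mul_le M
          ι.2.injective (nonuniformEvent M θ ι.1))
        exact graphLaw_real_inter_removeTouching M _ ι.1 _ _
    _ ≤ (∑ ι : truncatedNodes ω ℓ → Fin N,
        (2 * M.γ / N : ℝ) ^ E * (M.graphLaw N).real (nonuniformEvent M θ ι)) / N := by
        gcongr
        rw [← Finset.sum_subtype (Finset.univ.filter fun ι : truncatedNodes ω ℓ → Fin N =>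
          IsIncreasing ι) (by simp)
          fun ι => (2 * M.γ / N : ℝ) ^ E * (M.graphLaw N).real (nonuniformEvent M θ ι)]
        exact Finset.sum_le_sum_of_subset_of_nonneg (Finset.filter_subset _ _)
          fun _ _ _ => by positivity
    _ = _ := by
        rw [← Finset.mul_sum, div_pow, pow_succ]
        field_simp

/-- The deviation of the correlation in the graph from the one in a planted tree forces the rest
of the graph to be non-uniform at the planted vertices. -/
theorem exists_planted_near [Nonempty X] (ω : List ℕ → List C) {t ℓ : ℕ} (ht : t ≤ ℓ) {ε : ℝ}
    (hε : 0 < ε) :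
    ∃ θ : ℝ, 0 < θ ∧ ∀ (N : ℕ) (ι : truncatedNodes ω ℓ → Fin N), IsIncreasing ι →
      ∀ g ∈ plantedTreeEvent ω ℓ ι,
      0 < (multigraphOfLists N
        (removeTouching (innerSet (nodeDepth ω ℓ) ℓ) ι g)).partitionFunction M.ψ →
      removeTouching (innerSet (nodeDepth ω ℓ) ℓ) ι g ∉ nonuniformEvent M θ ι →
      |(multigraphOfLists N g).rootCorrelation M.ψ (ι (treeRoot ω ℓ)) t
        - (truncatedTree ω ℓ).rootCorrelation M.ψ (treeRoot ω ℓ) t| < ε := by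
  classical
  obtain ⟨θ, hθ, h⟩ := (isLayered_truncatedTree ω ℓ).exists_rootCorrelation_near M.ψ ht hε
  refine ⟨θ, hθ, fun N ι hι g hg hZ hu => h N ι hι.injective g hg hZ fun ξ => ?_⟩
  by_contra hlt
  exact hu ⟨hZ, ξ, not_lt.1 hlt⟩

theorem partitionFunction_pos_of_rootCorrelation_pos {V : Type*} [Fintype V]
    {G : LabeledMultigraph V C} {ψ : C → Sym2 X → ℝ≥0} {r : V} {t : ℕ}
    (h : 0 < G.rootCorrelation ψ r t) : 0 < G.partitionFunction ψ := by
  refine lt_of_le_of_ne (G.partitionFunction_nonneg ψ) fun h0 => ?_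
  rw [LabeledMultigraph.rootCorrelation_eq_zero h0.symm] at h
  exact lt_irrefl _ h

theorem eventually_graph_le_tree [Finite C] [Nonempty X]
    (htype : ∀ a : X, Tendsto (fun N => M.typeSecondMoment N a) atTop (𝓝 0)) {t ℓ : ℕ} (ht : t ≤ ℓ)
    {ε ε' κ : ℝ} (hε' : 0 ≤ ε') (hε : ε' < ε) (hκ : 0 < κ) :
    ∀ᶠ N in atTop, (M.rootedGraphLaw N).real
        {z | ε ≤ (multigraphOfLists N z.1).rootCorrelation M.ψ z.2 t}
      ≤ M.treeLaw.real {ω | ε' < (truncatedTree ω ℓ).rootCorrelation M.ψ (treeRoot ω ℓ) t} + κ := by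
  classical
  set S : Set (List ℕ → List C) :=
    {ω | (truncatedTree ω ℓ).rootCorrelation M.ψ (treeRoot ω ℓ) t ≤ ε'} with hSdef
  obtain ⟨F, hFS, hFinj, hF⟩ := treeLaw_approx M ℓ S (by
    intro ω hω ω' hω'
    simp only [hSdef, Set.mem_ofPred_eq] at hω ⊢
    rwa [rootCorrelation_eq_of_mem_treeCylinder M.ψ hω']) (half_pos hκ)
  have hcompl : M.treeLaw.real {ω | ε' < (truncatedTree ω ℓ).rootCorrelation M.ψ (treeRoot ω ℓ) t}
      ≥ 1 - M.treeLaw.real S := by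
    have : {ω | ε' < (truncatedTree ω ℓ).rootCorrelation M.ψ (treeRoot ω ℓ) t} = Sᶜ := by
      ext ω; simp [hSdef]
    rw [this]
    have h1 := measureReal_union_le (μ := M.treeLaw) S Sᶜ
    rw [Set.union_compl_self] at h1
    have h2 : M.treeLaw.real Set.univ = 1 := by simp
    linarith
  choose! θ hθ hnear using fun ω (_ : ω ∈ F) => exists_planted_near M ω ht (sub_pos.2 hε)
  let bad : ∀ (ω : List ℕ → List C) (N : ℕ), (truncatedNodes ω ℓ → Fin N) →
    Set (Sym2 (Fin N) → List C) := fun ω N ι =>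
      removeTouching (innerSet (nodeDepth ω ℓ) ℓ) ι ⁻¹' nonuniformEvent M (θ ω) ι
  have hlim : Tendsto (fun N : ℕ => (1 - ∑ ω ∈ F, M.treeLaw.real (treeCylinder ω ℓ) *
      ((N.descFactorial (Fintype.card (truncatedNodes ω ℓ)) : ℝ)
        / (N : ℝ) ^ Fintype.card (truncatedNodes ω ℓ)))
      + ∑ ω ∈ F, (∑ ι : {ι : truncatedNodes ω ℓ → Fin N // IsIncreasing ι},
        (M.graphLaw N).real (plantedTreeEvent ω ℓ ι.1 ∩ bad ω N ι.1)) / N) atTop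
      (𝓝 ((1 - ∑ ω ∈ F, M.treeLaw.real (treeCylinder ω ℓ) * 1) + ∑ _ω ∈ F, 0)) := by
    refine Tendsto.add (tendsto_const_nhds.sub (tendsto_finsetSum _ fun ω _ =>
      (tendsto_descFactorial_div_pow _).const_mul _)) (tendsto_finsetSum _ fun ω hω => ?_)
    exact tendsto_planted_nonuniform M htype ω ℓ (hθ ω hω)
  have hlt : (1 - ∑ ω ∈ F, M.treeLaw.real (treeCylinder ω ℓ) * 1) + ∑ _ω ∈ F, (0 : ℝ)
      < M.treeLaw.real {ω | ε' < (truncatedTree ω ℓ).rootCorrelation M.ψ (treeRoot ω ℓ) t} + κ := by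
    simp only [mul_one, Finset.sum_const_zero]
    linarith
  filter_upwards [hlim.eventually (gt_mem_nhds hlt), eventually_ne_atTop 0] with N hN hN0
  refine le_trans ?_ hN.le
  let A : (List ℕ → List C) → Set ((Sym2 (Fin N) → List C) × Fin N) := fun ω =>
    matchedEvent ω ℓ fun _ => Set.univ
  have hsub : {z : (Sym2 (Fin N) → List C) × Fin N |
      ε ≤ (multigraphOfLists N z.1).rootCorrelation M.ψ z.2 t}
      ⊆ (⋃ ω ∈ F, A ω)ᶜ ∪ ⋃ ω ∈ F, matchedEvent ω ℓ (bad ω N) := by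
    rintro ⟨g, r⟩ hz
    simp only [Set.mem_ofPred_eq] at hz
    by_cases hA : (g, r) ∈ ⋃ ω ∈ F, A ω
    swap
    · exact Or.inl hA
    refine Or.inr ?_
    simp only [Set.mem_iUnion] at hA ⊢
    obtain ⟨ω, hω, ι, hι, hr, hg, -⟩ := hA
    refine ⟨ω, hω, ι, hι, hr, hg, ?_⟩
    by_contra hbad
    have hZ := partitionFunction_pos_of_rootCorrelation_pos
      ((hε'.trans_lt hε).trans_le hz)
    have h1 := hnear ω hω N ι hι g hg (partitionFunction_removeTouching_pos _ ι hZ) hbad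
    have h2 : (truncatedTree ω ℓ).rootCorrelation M.ψ (treeRoot ω ℓ) t ≤ ε' := hFS ω hω
    simp only at hr
    rw [hr] at h1
    have := (abs_lt.1 h1).2
    linarith
  have hfiniteN : MeasurableSet (⋃ ω ∈ F, A ω) := MeasurableSet.of_discrete
  have hAsum : (M.rootedGraphLaw N).real (⋃ ω ∈ F, A ω)
      = ∑ ω ∈ F, (M.rootedGraphLaw N).real (A ω) := by
    refine measureReal_biUnion_finset ?_ fun ω _ => MeasurableSet.of_discrete
    intro ω hω ω' hω' hne
    refine Set.disjoint_left.2 ?_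
    rintro z ⟨ι, hι, hr, hg, -⟩ ⟨ι', hι', hr', hg', -⟩
    exact hne (hFinj ω hω ω' hω' (hι.treeCode_eq hι' hg hg' (hr.trans hr'.symm)))
  have hAge : ∀ ω ∈ F, M.treeLaw.real (treeCylinder ω ℓ) *
      ((N.descFactorial (Fintype.card (truncatedNodes ω ℓ)) : ℝ)
        / (N : ℝ) ^ Fintype.card (truncatedNodes ω ℓ)) ≤ (M.rootedGraphLaw N).real (A ω) := by
    intro ω _
    rw [rootedGraphLaw_real_matchedEvent]
    simp only [Set.inter_univ]
    exact treeLaw_mul_descFactorial_le M ω ℓ hN0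
  have hAc : (M.rootedGraphLaw N).real (⋃ ω ∈ F, A ω)ᶜ
      ≤ 1 - (M.rootedGraphLaw N).real (⋃ ω ∈ F, A ω) := by
    rw [measureReal_compl hfiniteN]
    have := rootedGraphLaw_real_le_one M N Set.univ
    linarith
  calc _ ≤ (M.rootedGraphLaw N).real ((⋃ ω ∈ F, A ω)ᶜ ∪ ⋃ ω ∈ F, matchedEvent ω ℓ (bad ω N)) :=
        measureReal_mono hsub
    _ ≤ (M.rootedGraphLaw N).real (⋃ ω ∈ F, A ω)ᶜ
        + (M.rootedGraphLaw N).real (⋃ ω ∈ F, matchedEvent ω ℓ (bad ω N)) :=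
        measureReal_union_le _ _
    _ ≤ _ := by
        refine add_le_add ?_ ?_
        · have := Finset.sum_le_sum hAge
          rw [← hAsum] at this
          linarith
        · refine (measureReal_biUnion_finset_le _ _).trans (le_of_eq ?_)
          refine Finset.sum_congr rfl fun ω _ => ?_
          rw [rootedGraphLaw_real_matchedEvent]

theorem exists_eventually_le_graph [Finite C] [Nonempty X]
    (htype : ∀ a : X, Tendsto (fun N => M.typeSecondMoment N a) atTop (𝓝 0)) {δ : ℝ} (hδ : 0 < δ)
    (hdefined : ∀ᶠ N in atTop,
      δ ≤ (M.graphLaw N).real {g | 0 < (multigraphOfLists N g).partitionFunction M.ψ})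
    {t ℓ : ℕ} (ht : t ≤ ℓ) {ε ε' : ℝ} (hε : ε' < ε)
    (hpos : 0 < M.treeLaw.real
      {ω | ε < (truncatedTree ω ℓ).rootCorrelation M.ψ (treeRoot ω ℓ) t}) :
    ∃ δ' : ℝ, 0 < δ' ∧ ∀ᶠ N in atTop, δ' ≤ (M.rootedGraphLaw N).real
        {z | ε' ≤ (multigraphOfLists N z.1).rootCorrelation M.ψ z.2 t} := by
  classical
  obtain ⟨F, hFS, -, hF⟩ := treeLaw_approx M ℓ
    {ω | ε < (truncatedTree ω ℓ).rootCorrelation M.ψ (treeRoot ω ℓ) t} (by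
    intro ω hω ω' hω'
    simp only [Set.mem_ofPred_eq] at hω ⊢
    rwa [rootCorrelation_eq_of_mem_treeCylinder M.ψ hω']) hpos
  rw [sub_self] at hF
  obtain ⟨ω, hωF, hω⟩ := Finset.exists_lt_of_sum_lt (s := F) (f := fun _ => (0 : ℝ))
    (by simpa using hF)
  have hωε : ε < (truncatedTree ω ℓ).rootCorrelation M.ψ (treeRoot ω ℓ) t := hFS ω hωF
  obtain ⟨θ, hθ, hnear⟩ := exists_planted_near M ω ht (sub_pos.2 hε)
  set τ := M.treeLaw.real (treeCylinder ω ℓ)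
  have hlim := (((tendsto_descFactorial_div_pow (Fintype.card (truncatedNodes ω ℓ))).const_mul
    τ).mul_const δ).sub (tendsto_planted_nonuniform M htype ω ℓ hθ)
  refine ⟨τ * δ / 2, by positivity, ?_⟩
  have hlt : τ * δ / 2 < τ * 1 * δ - 0 := by
    have : 0 < τ * δ := by positivity
    linarith
  filter_upwards [hlim.eventually (lt_mem_nhds hlt), eventually_ne_atTop 0, hdefined]
    with N hN hN0 hZN
  refine hN.le.trans ?_
  let rem : (truncatedNodes ω ℓ → Fin N) → (Sym2 (Fin N) → List C) → Sym2 (Fin N) → List C :=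
    removeTouching (innerSet (nodeDepth ω ℓ) ℓ)
  let pos : Set (Sym2 (Fin N) → List C) :=
    {g | 0 < (multigraphOfLists N g).partitionFunction M.ψ}
  let good : (truncatedNodes ω ℓ → Fin N) → Set (Sym2 (Fin N) → List C) := fun ι =>
    rem ι ⁻¹' (pos \ nonuniformEvent M θ ι)
  have hsub : matchedEvent ω ℓ good ⊆
      {z | ε' ≤ (multigraphOfLists N z.1).rootCorrelation M.ψ z.2 t} := by
    rintro ⟨g, r⟩ ⟨ι, hι, hr, hg, hpos, hnon⟩
    have h1 := hnear N ι hι g hg hpos hnon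
    simp only at hr
    rw [hr] at h1
    have := (abs_lt.1 h1).1
    simp only [Set.mem_ofPred_eq]
    linarith
  refine le_trans ?_ (measureReal_mono hsub)
  rw [rootedGraphLaw_real_matchedEvent]
  have hterm : ∀ ι : {ι : truncatedNodes ω ℓ → Fin N // IsIncreasing ι},
      (M.graphLaw N).real (plantedTreeEvent ω ℓ ι.1) * δ
        - (M.graphLaw N).real (plantedTreeEvent ω ℓ ι.1 ∩ rem ι.1 ⁻¹' nonuniformEvent M θ ι.1)
      ≤ (M.graphLaw N).real (plantedTreeEvent ω ℓ ι.1 ∩ good ι.1) := by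
    intro ι
    have h1 : (M.graphLaw N).real (plantedTreeEvent ω ℓ ι.1) * δ
        ≤ (M.graphLaw N).real (plantedTreeEvent ω ℓ ι.1 ∩ rem ι.1 ⁻¹' pos) := by
      have he : (M.graphLaw N).real (plantedTreeEvent ω ℓ ι.1 ∩ rem ι.1 ⁻¹' pos)
          = (M.graphLaw N).real (plantedTreeEvent ω ℓ ι.1)
            * (M.graphLaw N).real (rem ι.1 ⁻¹' pos) :=
        graphLaw_real_inter_removeTouching M _ ι.1 _ _
      rw [he]
      refine mul_le_mul_of_nonneg_left (hZN.trans (measureReal_mono ?_)) measureReal_nonneg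
      exact fun g hg => partitionFunction_removeTouching_pos _ ι.1 hg
    have h2 : plantedTreeEvent ω ℓ ι.1 ∩ rem ι.1 ⁻¹' pos
        ⊆ (plantedTreeEvent ω ℓ ι.1 ∩ good ι.1)
          ∪ (plantedTreeEvent ω ℓ ι.1 ∩ rem ι.1 ⁻¹' nonuniformEvent M θ ι.1) := by
      rintro g ⟨hg, hp⟩
      by_cases hn : rem ι.1 g ∈ nonuniformEvent M θ ι.1
      · exact Or.inr ⟨hg, hn⟩
      · exact Or.inl ⟨hg, hp, hn⟩
    have h3 := (measureReal_mono (μ := M.graphLaw N) h2).trans (measureReal_union_le _ _)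
    linarith
  calc _ ≤ (∑ ι : {ι : truncatedNodes ω ℓ → Fin N // IsIncreasing ι},
        (M.graphLaw N).real (plantedTreeEvent ω ℓ ι.1)) / N * δ - _ :=
        sub_le_sub_right (mul_le_mul_of_nonneg_right
          (treeLaw_mul_descFactorial_le M ω ℓ hN0) hδ.le) _
    _ = (∑ ι : {ι : truncatedNodes ω ℓ → Fin N // IsIncreasing ι},
        ((M.graphLaw N).real (plantedTreeEvent ω ℓ ι.1) * δ
        - (M.graphLaw N).real
          (plantedTreeEvent ω ℓ ι.1 ∩ rem ι.1 ⁻¹' nonuniformEvent M θ ι.1))) / N := by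
        rw [Finset.sum_sub_distrib, ← Finset.sum_mul, sub_div, div_mul_eq_mul_div]
    _ ≤ _ := by
        gcongr with ι _
        exact hterm ι

end Solvability

theorem theorem1 {X C : Type*} [Fintype X] [Finite C] (M : PoissonEnsemble X C)
    (hdefined : ∃ δ : ℝ≥0∞, 0 < δ ∧ ∀ᶠ N in atTop, δ ≤ M.probDefined N)
    (htype : ∀ a : X, Tendsto (fun N => M.typeSecondMoment N a) atTop (𝓝 0)) :
    M.GraphSolvable ↔ M.TreeSolvable := by
  obtain ⟨δ, hδ, hdef⟩ := hdefined
  have hX : Nonempty X := by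
    obtain ⟨N, hN, hN0⟩ := (hdef.and (eventually_ne_atTop 0)).exists
    have hne : M.graphLaw N {g | 0 < (multigraphOfLists N g).partitionFunction M.ψ} ≠ 0 :=
      (hδ.trans_le hN).ne'
    obtain ⟨g, hg⟩ := nonempty_of_measure_ne_zero hne
    rw [Set.mem_ofPred_eq, LabeledMultigraph.partitionFunction_eq_sum] at hg
    obtain ⟨x, -, -⟩ := Finset.exists_ne_zero_of_sum_ne_zero hg.ne'
    exact ⟨x ⟨0, Nat.pos_of_ne_zero hN0⟩⟩
  have htop : δ ≠ ∞ := by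
    obtain ⟨N, hN⟩ := hdef.exists
    exact ne_top_of_le_ne_top (measure_ne_top _ _) hN
  have hdef' : ∀ᶠ N in atTop, δ.toReal ≤
      (M.graphLaw N).real {g | 0 < (multigraphOfLists N g).partitionFunction M.ψ} :=
    hdef.mono fun N hN => ENNReal.toReal_mono (measure_ne_top _ _) hN
  constructor
  · rintro ⟨ε, hε, h⟩
    refine ⟨ε / 2, half_pos hε, fun t => ?_⟩
    obtain ⟨δ₀, hδ₀, hfreq⟩ := h t
    have hδ₀top : δ₀ ≠ ∞ := by
      obtain ⟨N, hN⟩ := hfreq.exists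
      exact ne_top_of_le_ne_top (measure_ne_top _ _) hN
    have hd : 0 < δ₀.toReal := ENNReal.toReal_pos hδ₀.ne' hδ₀top
    refine ⟨ENNReal.ofReal (δ₀.toReal / 2), ENNReal.ofReal_pos.2 (half_pos hd), ?_⟩
    refine Eventually.frequently ?_
    filter_upwards [eventually_ge_atTop t] with ℓ hℓ
    rw [ENNReal.ofReal_le_iff_le_toReal (measure_ne_top _ _)]
    by_contra hlt
    have hlt := not_le.1 hlt
    have hev := eventually_graph_le_tree M htype hℓ (half_pos hε).le (half_lt_self hε)
      (show 0 < δ₀.toReal / 4 by positivity)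
    obtain ⟨N, hN, hN'⟩ := (hfreq.and_eventually hev).exists
    have h1 : δ₀.toReal ≤ (M.rootedGraphLaw N).real
        {z | ε ≤ (multigraphOfLists N z.1).rootCorrelation M.ψ z.2 t} :=
      ENNReal.toReal_mono (measure_ne_top _ _) hN
    rw [← measureReal_def] at hlt
    linarith
  · rintro ⟨ε, hε, h⟩
    refine ⟨ε / 2, half_pos hε, fun t => ?_⟩
    obtain ⟨δ₀, hδ₀, hfreq⟩ := h t
    obtain ⟨ℓ, hℓ, htℓ⟩ := (hfreq.and_eventually (eventually_ge_atTop t)).exists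
    obtain ⟨δ', hδ', hev⟩ := exists_eventually_le_graph M htype
      (ENNReal.toReal_pos hδ.ne' htop) hdef' htℓ (half_lt_self hε)
      (ENNReal.toReal_pos (hδ₀.trans_le hℓ).ne' (measure_ne_top _ _))
    refine ⟨ENNReal.ofReal δ', ENNReal.ofReal_pos.2 hδ', Eventually.frequently ?_⟩
    filter_upwards [hev] with N hN
    rw [ENNReal.ofReal_le_iff_le_toReal (measure_ne_top _ _)]
    exact hN
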